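/- **Theorem (Parabolic Poincaré inequality).** Let $d\ge 1$, let $K_t\subset\mathbb R$ be a bounded interval of length $h_t>0$, let $K_x\subset\mathbb R^d$ be a (non-degenerate) $d$-simplex with diameter $h_x$, and let $K=K_t\times K_x$. The simplex is called shape regular with parameter $\sigma$ if it contains a ball of some radius $\rho>0$ with $h_x\le\sigma\rho$. Let $H^1_0(K_x)$ be the closure of $C_c^\infty$ (on the interior of $K_x$) in $H^1(K_x)$, equipped with the norm $\|\nabla_x w\|_{L^2(K_x)}$, and let $H^{-1}(K_x)$ be its dual with the dual norm $\|\xi\|_{H^{-1}(K_x)}=\sup_{w\in H_0^1(K_x)\setminus\{0\}}\langle \xi,w\rangle/\|\nabla_x w\|_{L^2(K_x)}$; functions $f\in L^2(K_x)$ are identified with $w\mapsto\int_{K_x} f w\,\mathrm dx$. Let $\langle v\rangle_K$ denote the integral mean of $v$ over $K$. Let $\mathbb P_\ell(K_x)$ be the polynomials of total degree at most $\ell$ on $K_x$, and let $\mathbb P_k(K_t;V)$ be the polynomials in time of degree at most $k$ with coefficients in $V$. (a) For every $\sigma$ there is a constant $C<\infty$, depending only on $\sigma$, such that for all such cells $K$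 with $K_x$ shape regular with parameter $\sigma$, every $v\in L^2(K_t;H^1(K_x))\cap H^1(K_t;H^{-1}(K_x))$ satisfies $$\|v-\langle v\rangle_K\|_{L^2(K)}\le C\Big(h_x\,\|\nabla_x v\|_{L^2(K)}+\frac{h_t}{h_x}\,\|\partial_t v\|_{L^2(K_t;H^{-1}(K_x))}\Big).$$ (b) For all $k,\ell\in\mathbb N_0$ and every $\sigma$ there is a constant $C<\infty$, depending only on $k$, $\ell$ and $\sigma$, such that for all such cells $K$ with $K_x$ shape regular with parameter $\sigma$, and every $v\in L^2(K_t;H^1(K_x))\cap H^1(K_t;H^{-1}(K_x))$, the following three minima are attained and $$\min_{v_h\in\mathbb P_k(K_t;\mathbb P_\ell(K_x))}\|v-v_h\|_{L^2(K)}\le C\Big(h_x\min_{v_x\in L^2(K_t;\mathbb P_\ell(K_x))}\|\nabla_x(v-v_x)\|_{L^2(K)}+\frac{h_t}{h_x}\min_{v_t\in\mathbb P_k(K_t;H^{-1}(K_x))}\|\partial_t(v-v_t)\|_{L^2(K_t;H^{-1}(K_x))}\Big).$$ -/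

import Mathlib

open MeasureTheory Set
open scoped ENNReal NNReal ContDiff InnerProductSpace

noncomputable section

namespace ParabolicPoincare

/-! ### Lebesgue, Sobolev and negative-order spaces on a subset of `ℝᵈ` -/

/-- `L²(U; F)` for `U ⊆ ℝᵈ`. -/
abbrev L2 {d : ℕ} (U : Set (EuclideanSpace ℝ (Fin d))) (F : Type*) [NormedAddCommGroup F] :=
  Lp F 2 (volume.restrict U)

/-- `φ ∈ C_c^∞(U)`, for functions extended by zero to the whole space. -/
def IsTestFunction {X : Type*} [NormedAddCommGroup X] [NormedSpace ℝ X] (U : Set X)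
    (φ : X → ℝ) : Prop :=
  ContDiff ℝ ∞ φ ∧ HasCompactSupport φ ∧ tsupport φ ⊆ U

/-- `g` is the weak gradient of `u` on `U`: `∫_U u ∇φ = - ∫_U φ g` for all `φ ∈ C_c^∞(U)`. -/
def IsWeakGradient {d : ℕ} (U : Set (EuclideanSpace ℝ (Fin d))) (u : L2 U ℝ)
    (g : L2 U (EuclideanSpace ℝ (Fin d))) : Prop :=
  ∀ φ : EuclideanSpace ℝ (Fin d) → ℝ, IsTestFunction U φ →
    ∫ x in U, u x • gradient φ x = - ∫ x in U, φ x • g x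

section TestFunctions

variable {d : ℕ} {U : Set (EuclideanSpace ℝ (Fin d))}

theorem IsTestFunction.add {φ ψ : EuclideanSpace ℝ (Fin d) → ℝ} (hφ : IsTestFunction U φ)
    (hψ : IsTestFunction U ψ) : IsTestFunction U (φ + ψ) :=
  ⟨hφ.1.add hψ.1, hφ.2.1.add hψ.2.1,
    (tsupport_add φ ψ).trans (union_subset hφ.2.2 hψ.2.2)⟩

theorem IsTestFunction.const_smul {φ : EuclideanSpace ℝ (Fin d) → ℝ} (hφ : IsTestFunction U φ)
    (c : ℝ) : IsTestFunction U (c • φ) :=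
  ⟨contDiff_const.smul hφ.1, hφ.2.1.smul_left (f := fun _ => c),
    (tsupport_smul_subset_right (fun _ => c) φ).trans hφ.2.2⟩

theorem IsTestFunction.differentiable {φ : EuclideanSpace ℝ (Fin d) → ℝ}
    (hφ : IsTestFunction U φ) : Differentiable ℝ φ :=
  hφ.1.differentiable (by simp)

theorem IsTestFunction.continuous_gradient {φ : EuclideanSpace ℝ (Fin d) → ℝ}
    (hφ : IsTestFunction U φ) : Continuous (gradient φ) :=
  (InnerProductSpace.toDual ℝ _).symm.continuous.comp (hφ.1.continuous_fderiv (by simp))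

theorem IsTestFunction.hasCompactSupport_gradient {φ : EuclideanSpace ℝ (Fin d) → ℝ}
    (hφ : IsTestFunction U φ) : HasCompactSupport (gradient φ) :=
  (hφ.2.1.fderiv (𝕜 := ℝ)).comp_left (g := (InnerProductSpace.toDual ℝ _).symm) (map_zero _)

theorem IsTestFunction.memLp {φ : EuclideanSpace ℝ (Fin d) → ℝ} (hφ : IsTestFunction U φ) :
    MemLp φ 2 (volume.restrict U) :=
  (hφ.1.continuous.memLp_of_hasCompactSupport hφ.2.1).restrict U

theorem IsTestFunction.memLp_gradient {φ : EuclideanSpace ℝ (Fin d) → ℝ}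
    (hφ : IsTestFunction U φ) : MemLp (gradient φ) 2 (volume.restrict U) :=
  (hφ.continuous_gradient.memLp_of_hasCompactSupport hφ.hasCompactSupport_gradient).restrict U

theorem IsTestFunction.integrable_smul_gradient {φ : EuclideanSpace ℝ (Fin d) → ℝ}
    (hφ : IsTestFunction U φ) (u : L2 U ℝ) :
    Integrable (fun x => u x • gradient φ x) (volume.restrict U) :=
  memLp_one_iff_integrable.1 (MemLp.smul (p := 2) (q := 2) hφ.memLp_gradient (Lp.memLp u))

theorem IsTestFunction.integrable_smul {φ : EuclideanSpace ℝ (Fin d) → ℝ}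
    (hφ : IsTestFunction U φ) (g : L2 U (EuclideanSpace ℝ (Fin d))) :
    Integrable (fun x => φ x • g x) (volume.restrict U) :=
  memLp_one_iff_integrable.1 (MemLp.smul (p := 2) (q := 2) (Lp.memLp g) hφ.memLp)

end TestFunctions

/-- The space `H¹(U)`, realized as the pairs `(u, ∇u)` of a function in `L²(U)` and its weak gradient in
`L²(U)`, inside the Hilbert space `L²(U) × L²(U; ℝᵈ)`. -/
def H1Submodule {d : ℕ} (U : Set (EuclideanSpace ℝ (Fin d))) :
    Submodule ℝ (WithLp 2 (L2 U ℝ × L2 U (EuclideanSpace ℝ (Fin d)))) where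
  carrier := {z | IsWeakGradient U z.fst z.snd}
  zero_mem' := by
    intro φ _
    have h1 : ∫ x in U, (0 : L2 U ℝ) x • gradient φ x = 0 := by
      refine integral_eq_zero_of_ae ?_
      filter_upwards [Lp.coeFn_zero ℝ 2 (volume.restrict U)] with x hx
      rw [hx, Pi.zero_apply, zero_smul, Pi.zero_apply]
    have h2 : ∫ x in U, φ x • (0 : L2 U (EuclideanSpace ℝ (Fin d))) x = 0 := by
      refine integral_eq_zero_of_ae ?_
      filter_upwards [Lp.coeFn_zero (EuclideanSpace ℝ (Fin d)) 2 (volume.restrict U)] with x hx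
      rw [hx, Pi.zero_apply, smul_zero]
    change ∫ x in U, (0 : L2 U ℝ) x • gradient φ x
      = - ∫ x in U, φ x • (0 : L2 U (EuclideanSpace ℝ (Fin d))) x
    rw [h1, h2, neg_zero]
  add_mem' := by
    intro y z hy hz φ hφ
    have h1 : ∫ x in U, (y.fst + z.fst : L2 U ℝ) x • gradient φ x
        = ∫ x in U, (y.fst x • gradient φ x + z.fst x • gradient φ x) := by
      refine integral_congr_ae ?_
      filter_upwards [Lp.coeFn_add y.fst z.fst] with x hx
      rw [hx, Pi.add_apply, add_smul]
    have h2 : ∫ x in U, φ x • (y.snd + z.snd : L2 U (EuclideanSpace ℝ (Fin d))) x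
        = ∫ x in U, (φ x • y.snd x + φ x • z.snd x) := by
      refine integral_congr_ae ?_
      filter_upwards [Lp.coeFn_add y.snd z.snd] with x hx
      rw [hx, Pi.add_apply, smul_add]
    change ∫ x in U, (y.fst + z.fst : L2 U ℝ) x • gradient φ x
      = - ∫ x in U, φ x • (y.snd + z.snd : L2 U (EuclideanSpace ℝ (Fin d))) x
    rw [h1, h2, integral_add (hφ.integrable_smul_gradient _) (hφ.integrable_smul_gradient _),
      integral_add (hφ.integrable_smul _) (hφ.integrable_smul _), hy φ hφ, hz φ hφ, neg_add]
  smul_mem' := by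
    intro c z hz φ hφ
    have h1 : ∫ x in U, (c • z.fst : L2 U ℝ) x • gradient φ x
        = ∫ x in U, c • (z.fst x • gradient φ x) := by
      refine integral_congr_ae ?_
      filter_upwards [Lp.coeFn_smul c z.fst] with x hx
      rw [hx, Pi.smul_apply, smul_assoc]
    have h2 : ∫ x in U, φ x • (c • z.snd : L2 U (EuclideanSpace ℝ (Fin d))) x
        = ∫ x in U, c • (φ x • z.snd x) := by
      refine integral_congr_ae ?_
      filter_upwards [Lp.coeFn_smul c z.snd] with x hx
      rw [hx, Pi.smul_apply, smul_comm]
    change ∫ x in U, (c • z.fst : L2 U ℝ) x • gradient φ x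
      = - ∫ x in U, φ x • (c • z.snd : L2 U (EuclideanSpace ℝ (Fin d))) x
    rw [h1, h2, integral_smul, integral_smul, hz φ hφ, smul_neg]

/-- The Sobolev space `H¹(U)`, with the norm `(‖u‖² + ‖∇u‖²)^{1/2}`. -/
def H1 {d : ℕ} (U : Set (EuclideanSpace ℝ (Fin d))) : Type := H1Submodule U

instance {d : ℕ} (U : Set (EuclideanSpace ℝ (Fin d))) : NormedAddCommGroup (H1 U) :=
  inferInstanceAs (NormedAddCommGroup (H1Submodule U))

instance {d : ℕ} (U : Set (EuclideanSpace ℝ (Fin d))) : InnerProductSpace ℝ (H1 U) :=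
  inferInstanceAs (InnerProductSpace ℝ (H1Submodule U))

/-- The underlying `L²` function of `u ∈ H¹(U)`. -/
def H1.val {d : ℕ} {U : Set (EuclideanSpace ℝ (Fin d))} : H1 U →L[ℝ] L2 U ℝ :=
  (WithLp.fstL 2 ℝ _ _).comp (H1Submodule U).subtypeL

/-- The weak gradient `∇u ∈ L²(U; ℝᵈ)` of `u ∈ H¹(U)`. -/
def H1.grad {d : ℕ} {U : Set (EuclideanSpace ℝ (Fin d))} :
    H1 U →L[ℝ] L2 U (EuclideanSpace ℝ (Fin d)) :=
  (WithLp.sndL 2 ℝ _ _).comp (H1Submodule U).subtypeL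

/-- `u ∈ H¹(U)` is the function `φ`, with the classical gradient of `φ` as its weak gradient. -/
def H1.IsRepresentedBy {d : ℕ} {U : Set (EuclideanSpace ℝ (Fin d))} (u : H1 U)
    (φ : EuclideanSpace ℝ (Fin d) → ℝ) : Prop :=
  H1.val u =ᵐ[volume.restrict U] φ ∧ H1.grad u =ᵐ[volume.restrict U] gradient φ

theorem H1.isRepresentedBy_zero {d : ℕ} {U : Set (EuclideanSpace ℝ (Fin d))} :
    H1.IsRepresentedBy (0 : H1 U) 0 := by
  refine ⟨?_, ?_⟩
  · rw [map_zero]; exact Lp.coeFn_zero _ _ _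
  · rw [map_zero]
    filter_upwards [Lp.coeFn_zero (EuclideanSpace ℝ (Fin d)) 2 (volume.restrict U)] with x hx
    rw [hx]
    have h0 : fderiv ℝ (0 : EuclideanSpace ℝ (Fin d) → ℝ) x = 0 := by simp
    simp only [gradient, h0, map_zero, Pi.zero_apply]

theorem H1.IsRepresentedBy.add {d : ℕ} {U : Set (EuclideanSpace ℝ (Fin d))} {u v : H1 U}
    {φ ψ : EuclideanSpace ℝ (Fin d) → ℝ} (hu : H1.IsRepresentedBy u φ) (hv : H1.IsRepresentedBy v ψ)
    (hφ : Differentiable ℝ φ) (hψ : Differentiable ℝ ψ) : H1.IsRepresentedBy (u + v) (φ + ψ) := by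
  refine ⟨?_, ?_⟩
  · refine (Lp.coeFn_add (H1.val u) (H1.val v)).trans ?_
    filter_upwards [hu.1, hv.1] with x h1 h2
    rw [Pi.add_apply, Pi.add_apply, h1, h2]
  · refine (Lp.coeFn_add (H1.grad u) (H1.grad v)).trans ?_
    filter_upwards [hu.2, hv.2] with x h1 h2
    rw [Pi.add_apply, h1, h2]
    simp only [gradient]
    rw [fderiv_add (hφ x) (hψ x), map_add]

theorem H1.IsRepresentedBy.const_smul {d : ℕ} {U : Set (EuclideanSpace ℝ (Fin d))} {u : H1 U}
    {φ : EuclideanSpace ℝ (Fin d) → ℝ} (hu : H1.IsRepresentedBy u φ) (hφ : Differentiable ℝ φ)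
    (c : ℝ) : H1.IsRepresentedBy (c • u) (c • φ) := by
  refine ⟨?_, ?_⟩
  · refine (Lp.coeFn_smul c (H1.val u)).trans ?_
    filter_upwards [hu.1] with x h1
    exact congrArg (c • ·) h1
  · refine (Lp.coeFn_smul c (H1.grad u)).trans ?_
    filter_upwards [hu.2] with x h1
    have h2 : gradient (c • φ) x = c • gradient φ x := by
      simp only [gradient]
      rw [fderiv_const_smul (hφ x), map_smulₛₗ]
      simp
    rw [h2]
    exact congrArg (c • ·) h1

/-- `C_c^∞(U)` as a subspace of `H¹(U)`. -/
def testSubspace {d : ℕ} (U : Set (EuclideanSpace ℝ (Fin d))) : Submodule ℝ (H1 U) where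
  carrier := {u | ∃ φ : EuclideanSpace ℝ (Fin d) → ℝ, IsTestFunction U φ ∧ H1.IsRepresentedBy u φ}
  zero_mem' := ⟨0, ⟨contDiff_const, HasCompactSupport.zero, by simp [tsupport]⟩,
    H1.isRepresentedBy_zero⟩
  add_mem' := fun ⟨φ, hφ, hu⟩ ⟨ψ, hψ, hv⟩ =>
    ⟨φ + ψ, hφ.add hψ, hu.add hv hφ.differentiable hψ.differentiable⟩
  smul_mem' := fun c _ ⟨φ, hφ, hu⟩ =>
    ⟨c • φ, hφ.const_smul c, hu.const_smul hφ.differentiable c⟩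

/-- `H₀¹(U)`: the closure of `C_c^∞(U)` in `H¹(U)`. It is a type of its own because it carries
the norm `‖∇w‖_{L²(U)}`, not the norm of `H¹(U)`. -/
def H10 {d : ℕ} (U : Set (EuclideanSpace ℝ (Fin d))) : Type :=
  (testSubspace U).topologicalClosure

instance {d : ℕ} (U : Set (EuclideanSpace ℝ (Fin d))) : AddCommGroup (H10 U) :=
  inferInstanceAs (AddCommGroup (testSubspace U).topologicalClosure)

instance {d : ℕ} (U : Set (EuclideanSpace ℝ (Fin d))) : Module ℝ (H10 U) :=
  inferInstanceAs (Module ℝ (testSubspace U).topologicalClosure)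

/-- The inclusion of `H₀¹(U)` in `H¹(U)`. -/
def H10.toH1 {d : ℕ} {U : Set (EuclideanSpace ℝ (Fin d))} : H10 U →ₗ[ℝ] H1 U :=
  (testSubspace U).topologicalClosure.subtype

/-- The gradient on `H₀¹(U)`. -/
def H10.grad {d : ℕ} {U : Set (EuclideanSpace ℝ (Fin d))} :
    H10 U →ₗ[ℝ] L2 U (EuclideanSpace ℝ (Fin d)) :=
  (H1.grad (U := U)).toLinearMap ∘ₗ H10.toH1

/-- `H₀¹(U)` is normed by `w ↦ ‖∇w‖_{L²(U)}`. -/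
instance {d : ℕ} (U : Set (EuclideanSpace ℝ (Fin d))) : SeminormedAddCommGroup (H10 U) :=
  SeminormedAddCommGroup.induced _ _ (H10.grad (U := U))

instance {d : ℕ} (U : Set (EuclideanSpace ℝ (Fin d))) : NormedSpace ℝ (H10 U) :=
  NormedSpace.induced _ _ _ (H10.grad (U := U))

theorem H10.norm_def {d : ℕ} {U : Set (EuclideanSpace ℝ (Fin d))} (w : H10 U) :
    ‖w‖ = ‖H10.grad w‖ := rfl

/-- `H⁻¹(U)`: the dual of `H₀¹(U)`, with the dual norm
`‖ξ‖ = sup_w ⟨ξ, w⟩ / ‖∇w‖_{L²(U)}`. -/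
abbrev HNeg {d : ℕ} (U : Set (EuclideanSpace ℝ (Fin d))) := StrongDual ℝ (H10 U)

/-- The dual norm is definite. -/
instance {d : ℕ} (U : Set (EuclideanSpace ℝ (Fin d))) : NormedAddCommGroup (HNeg U) :=
  NormedAddCommGroup.ofSeparation fun ξ h => by
    ext w
    exact norm_le_zero_iff.1 ((ξ.le_opNorm w).trans_eq (by rw [h, zero_mul]))

/-- Friedrichs' inequality for test functions on a bounded set (used to embed `L²(U)` in
`H⁻¹(U)`). -/
theorem friedrichs_test {d : ℕ} (hd : 0 < d) {U : Set (EuclideanSpace ℝ (Fin d))} {R : ℝ}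
    (hR : ∀ x ∈ U, ‖x‖ ≤ R) {φ : EuclideanSpace ℝ (Fin d) → ℝ} (hφ : IsTestFunction U φ) :
    ∫ x, φ x ^ 2 ≤ 4 * R ^ 2 * ∫ x, ‖gradient φ x‖ ^ 2 := by
  set e : EuclideanSpace ℝ (Fin d) := EuclideanSpace.single ⟨0, hd⟩ 1 with he
  have hce : ‖e‖ = 1 := by simp [he]
  have hcφ := hφ.1.continuous
  have hcg := hφ.continuous_gradient
  have hdf := hφ.differentiable
  have hfd : ∀ x, fderiv ℝ φ x e = ⟪gradient φ x, e⟫_ℝ := fun x => by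
    simp [gradient]
  have hzero : ∀ x, x ∉ U → φ x = 0 := fun x hx =>
    image_eq_zero_of_notMem_tsupport fun h => hx (hφ.2.2 h)
  have hdsq : ∀ x, fderiv ℝ (fun y => φ y ^ 2) x e = 2 * φ x * ⟪gradient φ x, e⟫_ℝ := fun x => by
    rw [fderiv_fun_pow 2 (hdf x), ← hfd]
    simp
  have hdg : ∀ x, fderiv ℝ (fun y : EuclideanSpace ℝ (Fin d) => ⟪e, y⟫_ℝ) x e = 1 := fun x => by
    have : HasFDerivAt (fun y : EuclideanSpace ℝ (Fin d) => ⟪e, y⟫_ℝ) (innerSL ℝ e) x :=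
      (innerSL ℝ e).hasFDerivAt
    rw [this.fderiv]
    simp [hce]
  have hci : Continuous fun x : EuclideanSpace ℝ (Fin d) => ⟪e, x⟫_ℝ := by fun_prop
  have hcd : Continuous fun x => 2 * φ x * ⟪gradient φ x, e⟫_ℝ := by fun_prop
  have hs2 : HasCompactSupport fun x => φ x ^ 2 :=
    hφ.2.1.comp_left (g := fun t : ℝ => t ^ 2) (by simp)
  have hsg : HasCompactSupport fun x => ‖gradient φ x‖ ^ 2 :=
    hφ.hasCompactSupport_gradient.comp_left (g := fun t => ‖t‖ ^ 2) (by simp)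
  have hsd : HasCompactSupport fun x => 2 * φ x * ⟪gradient φ x, e⟫_ℝ := by
    refine HasCompactSupport.mul_right ?_
    exact hφ.2.1.mul_left
  have i2 : Integrable fun x => φ x ^ 2 :=
    (by fun_prop : Continuous _).integrable_of_hasCompactSupport hs2
  have ig : Integrable fun x => ‖gradient φ x‖ ^ 2 :=
    (by fun_prop : Continuous _).integrable_of_hasCompactSupport hsg
  have hparts := integral_mul_fderiv_eq_neg_fderiv_mul_of_integrable (μ := volume) (v := e)
    (f := fun y => φ y ^ 2) (g := fun y : EuclideanSpace ℝ (Fin d) => ⟪e, y⟫_ℝ)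
    (by
      simp only [hdsq]
      exact (hcd.mul hci).integrable_of_hasCompactSupport hsd.mul_right)
    (by simpa only [hdg, mul_one] using i2)
    (((hcφ.pow 2).mul hci).integrable_of_hasCompactSupport hs2.mul_right)
    (fun x _ => (hdf x).pow 2) (fun x _ => (innerSL ℝ e).differentiableAt)
  simp only [hdg, mul_one, hdsq] at hparts
  have hle : ∫ x, φ x ^ 2 ≤ ∫ x, (φ x ^ 2 / 2 + 2 * R ^ 2 * ‖gradient φ x‖ ^ 2) := by
    rw [hparts, ← integral_neg]
    refine integral_mono ((hcd.mul hci).integrable_of_hasCompactSupport hsd.mul_right).neg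
      ((i2.div_const 2).add (ig.const_mul _)) fun x => ?_
    simp only
    by_cases hx : x ∈ U
    · have h1 : |⟪e, x⟫_ℝ| ≤ R := by
        simpa [hce] using (abs_real_inner_le_norm e x).trans (by simpa [hce] using hR x hx)
      have h2 : |⟪gradient φ x, e⟫_ℝ| ≤ ‖gradient φ x‖ := by
        simpa [hce] using abs_real_inner_le_norm (gradient φ x) e
      have h3 : (⟪gradient φ x, e⟫_ℝ * ⟪e, x⟫_ℝ) ^ 2 ≤ R ^ 2 * ‖gradient φ x‖ ^ 2 := by
        rw [← sq_abs, abs_mul, mul_pow, mul_comm]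
        gcongr
      nlinarith [sq_nonneg (φ x + 2 * (⟪gradient φ x, e⟫_ℝ * ⟪e, x⟫_ℝ))]
    · rw [hzero x hx]
      simp
      positivity
  rw [integral_add (i2.div_const 2) (ig.const_mul _), integral_div, integral_const_mul] at hle
  linarith

theorem L2.norm_sq_eq_integral {d : ℕ} {U : Set (EuclideanSpace ℝ (Fin d))} {F : Type*}
    [NormedAddCommGroup F] [InnerProductSpace ℝ F] (f : L2 U F)
    {h : EuclideanSpace ℝ (Fin d) → F} (hf : f =ᵐ[volume.restrict U] h)
    (hz : ∀ x, x ∉ U → h x = 0) : ‖f‖ ^ 2 = ∫ x, ‖h x‖ ^ 2 := by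
  rw [← setIntegral_eq_integral_of_forall_compl_eq_zero (s := U) (f := fun x => ‖h x‖ ^ 2)
    (fun x hx => by simp [hz x hx]), ← real_inner_self_eq_norm_sq, L2.inner_def]
  refine integral_congr_ae ?_
  filter_upwards [hf] with x hx
  rw [hx, real_inner_self_eq_norm_sq]

theorem friedrichs_test' {d : ℕ} (hd : 0 < d) {U : Set (EuclideanSpace ℝ (Fin d))} {R : ℝ}
    (hR : ∀ x ∈ U, ‖x‖ ≤ R) (hR0 : 0 ≤ R) {f : L2 U ℝ} {g : L2 U (EuclideanSpace ℝ (Fin d))}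
    {φ : EuclideanSpace ℝ (Fin d) → ℝ} (hφ : IsTestFunction U φ)
    (hf : f =ᵐ[volume.restrict U] φ) (hg : g =ᵐ[volume.restrict U] gradient φ) :
    ‖f‖ ≤ 2 * R * ‖g‖ := by
  have h := friedrichs_test hd hR hφ
  have e1 := L2.norm_sq_eq_integral f hf fun x hx =>
    image_eq_zero_of_notMem_tsupport fun h => hx (hφ.2.2 h)
  have e2 := L2.norm_sq_eq_integral g hg fun x hx => by
    have : fderiv ℝ φ x = 0 := by
      by_contra hne
      exact hx (hφ.2.2 (support_fderiv_subset ℝ hne))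
    simp [gradient, this]
  simp only [Real.norm_eq_abs, sq_abs] at e1
  rw [← e1, ← e2] at h
  refine (abs_le_of_sq_le_sq' ?_ (by positivity)).2
  rw [mul_pow, mul_pow]
  linarith

/-- Friedrichs' inequality on `H₀¹(U)` for bounded `U`. -/
theorem friedrichs {d : ℕ} (hd : 0 < d) {U : Set (EuclideanSpace ℝ (Fin d))}
    (hU : Bornology.IsBounded U) : ∃ C : ℝ, ∀ w : H10 U, ‖H1.val w.toH1‖ ≤ C * ‖w‖ := by
  obtain ⟨R, hR⟩ := hU.exists_norm_le
  refine ⟨2 * |R|, fun w => ?_⟩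
  have hcl : IsClosed {u : H1 U | ‖H1.val u‖ ≤ 2 * |R| * ‖H1.grad u‖} :=
    isClosed_le (H1.val (U := U)).continuous.norm
      (continuous_const.mul (H1.grad (U := U)).continuous.norm)
  have hsub : (testSubspace U : Set (H1 U)) ⊆ {u : H1 U | ‖H1.val u‖ ≤ 2 * |R| * ‖H1.grad u‖} := by
    rintro u ⟨φ, hφ, h⟩
    exact friedrichs_test' hd (fun x hx => (hR x hx).trans (le_abs_self R)) (abs_nonneg R) hφ
      h.1 h.2
  exact closure_minimal hsub hcl w.2

/-- The embedding `L²(U) ⊆ H⁻¹(U)`, `⟨f, w⟩ = ∫_U f w`, for bounded `U`. -/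
def toHNeg {d : ℕ} (hd : 0 < d) {U : Set (EuclideanSpace ℝ (Fin d))}
    (hU : Bornology.IsBounded U) : L2 U ℝ →L[ℝ] HNeg U :=
  LinearMap.mkContinuousOfExistsBound₂
    ((innerₗ (L2 U ℝ)).compl₂ ((H1.val (U := U)).toLinearMap ∘ₗ H10.toH1)) <| by
      obtain ⟨C, hC⟩ := friedrichs hd hU
      refine ⟨C, fun f w => ?_⟩
      calc ‖⟪f, H1.val w.toH1⟫_ℝ‖ ≤ ‖f‖ * ‖H1.val w.toH1‖ := norm_inner_le_norm _ _
        _ ≤ ‖f‖ * (C * ‖w‖) := by gcongr; exact hC w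
        _ = C * ‖f‖ * ‖w‖ := by ring

theorem toHNeg_apply {d : ℕ} (hd : 0 < d) {U : Set (EuclideanSpace ℝ (Fin d))}
    (hU : Bornology.IsBounded U) (f : L2 U ℝ) (w : H10 U) :
    toHNeg hd hU f w = ∫ x in U, f x * H1.val w.toH1 x := by
  change ⟪f, H1.val w.toH1⟫_ℝ = _
  rw [L2.inner_def]
  exact integral_congr_ae (Filter.Eventually.of_forall fun x => by simp [mul_comm])

/-! ### Functions of time -/

/-- `f ∈ L²((a, b); V)`. -/
def IsL2Time {V : Type*} [NormedAddCommGroup V] (a b : ℝ) (f : ℝ → V) : Prop :=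
  MemLp f 2 (volume.restrict (Ioo a b))

/-- The norm `(∫_a^b ‖f(t)‖² dt)^{1/2}` of `L²((a, b); V)`. -/
def normL2Time {V : Type*} [NormedAddCommGroup V] (a b : ℝ) (f : ℝ → V) : ℝ≥0∞ :=
  eLpNorm f 2 (volume.restrict (Ioo a b))

/-- `g` is the weak derivative of `f` on `(a, b)`:
`∫ φ' f = - ∫ φ g` in `V` for all `φ ∈ C_c^∞((a, b))`. -/
def IsWeakTimeDeriv {V : Type*} [NormedAddCommGroup V] [NormedSpace ℝ V] (a b : ℝ)
    (f g : ℝ → V) : Prop :=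
  ∀ φ : ℝ → ℝ, IsTestFunction (Ioo a b) φ →
    ∫ t in Ioo a b, deriv φ t • f t = - ∫ t in Ioo a b, φ t • g t

/-- `p` is a polynomial in time of degree at most `k` with coefficients in `S ⊆ V`. -/
def IsTimePoly {V : Type*} [AddCommGroup V] [Module ℝ V] (k : ℕ) (S : Set V) (p : ℝ → V) : Prop :=
  ∃ c : ℕ → V, (∀ i, c i ∈ S) ∧ ∀ t, p t = ∑ i ∈ Finset.range (k + 1), t ^ i • c i

/-! ### Functions on a time-space cell -/

/-- The interior of the simplex `K_x` spanned by the vertices of `s`. -/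
def cell {d : ℕ} (s : Affine.Simplex ℝ (EuclideanSpace ℝ (Fin d)) d) :
    Set (EuclideanSpace ℝ (Fin d)) :=
  interior (convexHull ℝ (range s.points))

theorem isBounded_cell {d : ℕ} (s : Affine.Simplex ℝ (EuclideanSpace ℝ (Fin d)) d) :
    Bornology.IsBounded (cell s) :=
  ((isBounded_convexHull.2 (finite_range s.points).isBounded)).subset interior_subset

/-- The diameter `h_x` of the simplex. -/
def cellDiam {d : ℕ} (s : Affine.Simplex ℝ (EuclideanSpace ℝ (Fin d)) d) : ℝ :=
  Metric.diam (convexHull ℝ (range s.points))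

/-- Shape regularity with parameter `σ`: the simplex contains a ball of some radius `ρ > 0` with
`h_x ≤ σ ρ`. -/
def IsShapeRegular {d : ℕ} (σ : ℝ) (s : Affine.Simplex ℝ (EuclideanSpace ℝ (Fin d)) d) : Prop :=
  ∃ (c : EuclideanSpace ℝ (Fin d)) (ρ : ℝ), 0 < ρ ∧
    Metric.closedBall c ρ ⊆ convexHull ℝ (range s.points) ∧ cellDiam s ≤ σ * ρ

/-- `ℙ_ℓ(U)`: polynomials of total degree at most `ℓ`, as elements of `H¹(U)`. -/
def polySpace {d : ℕ} (ℓ : ℕ) (U : Set (EuclideanSpace ℝ (Fin d))) : Set (H1 U) :=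
  {u | ∃ q : MvPolynomial (Fin d) ℝ, q.totalDegree ≤ ℓ ∧
    H1.val u =ᵐ[volume.restrict U] fun x => MvPolynomial.eval (fun i => x i) q}

/-- The norm of `L²(K)` for `K = (a, b) × U`, as `(∫_a^b ∫_U ‖F(t, x)‖² dx dt)^{1/2}`. -/
def normL2Cell {d : ℕ} {F : Type*} [NormedAddCommGroup F] (a b : ℝ)
    (U : Set (EuclideanSpace ℝ (Fin d))) (f : ℝ → EuclideanSpace ℝ (Fin d) → F) : ℝ≥0∞ :=
  (∫⁻ t in Ioo a b, ∫⁻ x in U, ‖f t x‖ₑ ^ 2) ^ (1 / 2 : ℝ)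

/-- The integral mean `⟨f⟩_K` over `K = (a, b) × U`. -/
def cellMean {d : ℕ} (a b : ℝ) (U : Set (EuclideanSpace ℝ (Fin d)))
    (f : ℝ → EuclideanSpace ℝ (Fin d) → ℝ) : ℝ :=
  ⨍ t in Ioo a b, ⨍ x in U, f t x

/-- `v ∈ L²((a, b); H¹(K_x)) ∩ H¹((a, b); H⁻¹(K_x))` with `∂ₜ v = g`. -/
def IsParabolic {d : ℕ} (hd : 0 < d) (a b : ℝ)
    (s : Affine.Simplex ℝ (EuclideanSpace ℝ (Fin d)) d)
    (v : ℝ → H1 (cell s)) (g : ℝ → HNeg (cell s)) : Prop :=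
  IsL2Time a b v ∧ IsL2Time a b g ∧
    IsWeakTimeDeriv a b (fun t => toHNeg hd (isBounded_cell s) (H1.val (v t))) g

/-- The errors `‖v - v_h‖_{L²(K)}` for `v_h ∈ ℙ_k(K_t; ℙ_ℓ(K_x))`. -/
def polyErrors {d : ℕ} (k ℓ : ℕ) (a b : ℝ) (U : Set (EuclideanSpace ℝ (Fin d)))
    (v : ℝ → H1 U) : Set ℝ≥0∞ :=
  {e | ∃ vh : ℝ → H1 U, IsTimePoly k (polySpace ℓ U) vh ∧
    e = normL2Cell a b U fun t => H1.val (v t - vh t)}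

/-- The errors `‖∇ₓ(v - vₓ)‖_{L²(K)}` for `vₓ ∈ L²(K_t; ℙ_ℓ(K_x))`. -/
def spaceErrors {d : ℕ} (ℓ : ℕ) (a b : ℝ) (U : Set (EuclideanSpace ℝ (Fin d)))
    (v : ℝ → H1 U) : Set ℝ≥0∞ :=
  {e | ∃ vx : ℝ → H1 U, IsL2Time a b vx ∧
    (∀ᵐ t ∂volume.restrict (Ioo a b), vx t ∈ polySpace ℓ U) ∧
    e = normL2Cell a b U fun t => H1.grad (v t - vx t)}

/-- The errors `‖∂ₜ(v - vₜ)‖_{L²(K_t; H⁻¹(K_x))}` for `vₜ ∈ ℙ_k(K_t; H⁻¹(K_x))`. -/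
def timeErrors {d : ℕ} (hd : 0 < d) (k : ℕ) (a b : ℝ)
    (s : Affine.Simplex ℝ (EuclideanSpace ℝ (Fin d)) d) (v : ℝ → H1 (cell s)) : Set ℝ≥0∞ :=
  {e | ∃ vt q : ℝ → HNeg (cell s), IsTimePoly k univ vt ∧ IsL2Time a b q ∧
    IsWeakTimeDeriv a b (fun t => toHNeg hd (isBounded_cell s) (H1.val (v t)) - vt t) q ∧
    e = normL2Time a b q}

end ParabolicPoincare

open ParabolicPoincare

/-! The proof replaces `v` by finitely many time-dependent coefficients and treats space and time
separately. On the cell one takes polynomials `q j` and test functions `N j`, supported well inside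
the inscribed ball, such that `∑ j, ⟨f, N j⟩ q j` reproduces every polynomial of degree at most `ℓ`.
This quasi-interpolation is stable in `L²`, so for almost every time its error is controlled by the
Poincaré inequality on the convex cell, with constant `h_x`, and any polynomial may first be
subtracted from `v t` (`IsDualSystem.norm_sub_quasiInterp_le`). Because `N j` lies in `H₀¹`, the
coefficient `t ↦ ⟨v t, N j⟩` has the weak derivative `⟨∂ₜv, N j⟩`. After subtraction of `vt t (N
j)`, the Poincaré inequality on the interval gives a constant `c j` with error at most `2 h_t ‖N j‖`
times the `H⁻¹` norm of `∂ₜ(v - vt)`. Scaling gives `‖q j‖ ‖N j‖ ≤ C / h_x`, which is the origin of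
the factor `h_t / h_x`. The approximant is `vh = ∑ j, (vt (N j) + c j) q j`
(`IsDualSystem.exists_approx`). The Poincaré inequality (`exists_poincare_const`) comes from
integrating along the segments between pairs of points; mollification carries it from smooth
functions to weak gradients. The constants so obtained depend on `d`, but an inscribed ball forces
`d + 1 ≤ σ` (`IsShapeRegular.dim_lt`), so only finitely many dimensions occur for a given `σ`. All
three minima come from orthogonal projection in Hilbert spaces. For the time minimum the
coefficients range over the infinite-dimensional `H⁻¹`: its norm satisfies the parallelogram law,
and the polynomials in time form a complete subspace. Part (a) is the estimate with `k = ℓ = 0` and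
vanishing `vx` and `vt`, followed by the passage from an arbitrary constant to the mean. -/

namespace ParabolicPoincare

/-! ### The Poincaré inequality on convex sets -/

section Poincare

open Module

/-- Jensen's inequality for the square, on a probability space. -/
theorem sq_enorm_integral_le {α F : Type*} [MeasurableSpace α] {μ : Measure α}
    [IsProbabilityMeasure μ] [NormedAddCommGroup F] [NormedSpace ℝ F] {f : α → F}
    (hf : AEStronglyMeasurable f μ) : ‖∫ x, f x ∂μ‖ₑ ^ 2 ≤ ∫⁻ x, ‖f x‖ₑ ^ 2 ∂μ := by
  have h1 : ‖∫ x, f x ∂μ‖ₑ ≤ eLpNorm f 1 μ := by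
    rw [eLpNorm_one_eq_lintegral_enorm]
    exact enorm_integral_le_lintegral_enorm f
  have h2 : eLpNorm f 1 μ ≤ eLpNorm f 2 μ :=
    eLpNorm_le_eLpNorm_of_exponent_le (by norm_num) hf
  have h3 : eLpNorm f 2 μ ^ 2 = ∫⁻ x, ‖f x‖ₑ ^ 2 ∂μ := by
    have := eLpNorm_nnreal_pow_eq_lintegral (f := f) (μ := μ) (p := 2) (by norm_num)
    simpa using this
  calc _ ≤ eLpNorm f 2 μ ^ 2 := by gcongr; exact h1.trans h2
    _ = _ := h3

variable {E : Type*} [NormedAddCommGroup E] [InnerProductSpace ℝ E] [FiniteDimensional ℝ E]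

theorem continuous_gradient {f : E → ℝ} (hf : ContDiff ℝ 1 f) : Continuous (gradient f) :=
  (InnerProductSpace.toDual ℝ _).symm.continuous.comp (hf.continuous_fderiv (by simp))

/-- The fundamental theorem of calculus on the segment from `x` to `y`, then Jensen on the unit
interval and Cauchy–Schwarz. -/
theorem sq_enorm_sub_le_lintegral_gradient {f : E → ℝ} (hf : ContDiff ℝ 1 f) (x y : E) :
    ‖f x - f y‖ₑ ^ 2 ≤
      ‖y - x‖ₑ ^ 2 * ∫⁻ s in Ioc (0 : ℝ) 1, ‖gradient f (x + s • (y - x))‖ₑ ^ 2 := by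
  have hd : ∀ s : ℝ, HasDerivAt (fun s : ℝ => f (x + s • (y - x)))
      ⟪gradient f (x + s • (y - x)), y - x⟫_ℝ s := by
    intro s
    have h1 : HasDerivAt (fun s : ℝ => x + s • (y - x)) (y - x) s := by
      simpa using ((hasDerivAt_id s).smul_const (y - x)).const_add x
    have h2 := ((hf.differentiable (by simp)) (x + s • (y - x))).hasFDerivAt.comp_hasDerivAt s h1
    simpa [gradient, Function.comp_def] using h2
  have hc : Continuous fun s : ℝ => ⟪gradient f (x + s • (y - x)), y - x⟫_ℝ := by
    have := continuous_gradient hf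
    fun_prop
  have hftc : ∫ s in (0 : ℝ)..1, ⟪gradient f (x + s • (y - x)), y - x⟫_ℝ = f y - f x := by
    rw [intervalIntegral.integral_eq_sub_of_hasDerivAt (fun s _ => hd s)
      (hc.intervalIntegrable _ _)]
    simp
  rw [intervalIntegral.integral_of_le zero_le_one] at hftc
  have : IsProbabilityMeasure (volume.restrict (Ioc (0 : ℝ) 1)) := ⟨by simp⟩
  rw [← enorm_neg, neg_sub, ← hftc, ← lintegral_const_mul' _ _ (by finiteness)]
  refine (sq_enorm_integral_le hc.aestronglyMeasurable).trans ?_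
  refine lintegral_mono fun s => ?_
  rw [← mul_pow, mul_comm]
  gcongr
  rw [← ofReal_norm, ← ofReal_norm, ← ofReal_norm, ← ENNReal.ofReal_mul (norm_nonneg _)]
  exact ENNReal.ofReal_le_ofReal (norm_inner_le_norm _ _)

variable [MeasurableSpace E] [BorelSpace E]

theorem lintegral_comp_homothety {k : E → ℝ≥0∞} (hk : Measurable k) (x : E) {s : ℝ} (hs : 0 < s) :
    ∫⁻ y, k (x + s • (y - x)) = ENNReal.ofReal ((s ^ finrank ℝ E)⁻¹) * ∫⁻ y, k y := by
  rw [lintegral_sub_right_eq_self (fun y => k (x + s • y)) x,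
    ← lintegral_add_left_eq_self k x]
  have h := Measure.map_addHaar_smul (volume : Measure E) hs.ne'
  have h2 : ∫⁻ y, k (x + y) ∂(Measure.map (s • ·) (volume : Measure E)) = ∫⁻ y, k (x + s • y) :=
    lintegral_map (by fun_prop) (by fun_prop)
  rw [← h2, h, lintegral_smul_measure, abs_of_pos (by positivity), smul_eq_mul]

/-- For fixed `x` the map `y ↦ x + s • (y - x)` is a homothety that keeps the convex set `V` inside
itself; its inverse Jacobian `s ^ (-dim)` is at most `2 ^ dim` when `s ≥ 1 / 2`. -/
theorem lintegral_lintegral_comp_lineMap_le_aux {k : E → ℝ≥0∞} (hk : Measurable k) {V : Set E}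
    (hV : MeasurableSet V) (hc : Convex ℝ V) {s : ℝ} (hs : 1 / 2 ≤ s) (hs1 : s ≤ 1) :
    ∫⁻ x in V, ∫⁻ y in V, k (x + s • (y - x)) ≤
      2 ^ finrank ℝ E * volume V * ∫⁻ y in V, k y := by
  have hs0 : 0 < s := by linarith
  calc ∫⁻ x in V, ∫⁻ y in V, k (x + s • (y - x))
      ≤ ∫⁻ x in V, 2 ^ finrank ℝ E * ∫⁻ y in V, k y := by
        refine setLIntegral_mono' hV fun x hx => ?_
        calc ∫⁻ y in V, k (x + s • (y - x)) ≤ ∫⁻ y, V.indicator k (x + s • (y - x)) := by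
              rw [← lintegral_indicator hV]
              refine lintegral_mono fun y => ?_
              by_cases hy : y ∈ V
              · rw [indicator_of_mem hy, indicator_of_mem]
                exact hc.add_smul_sub_mem hx hy ⟨hs0.le, hs1⟩
              · simp [hy]
          _ = ENNReal.ofReal ((s ^ finrank ℝ E)⁻¹) * ∫⁻ y in V, k y := by
              rw [lintegral_comp_homothety (hk.indicator hV) x hs0, lintegral_indicator hV]
          _ ≤ _ := by
              gcongr
              rw [← ENNReal.ofReal_ofNat, ← ENNReal.ofReal_pow (by norm_num), ← inv_pow]
              refine ENNReal.ofReal_le_ofReal (pow_le_pow_left₀ (by positivity) ?_ _)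
              rw [inv_le_comm₀ hs0 (by norm_num)]
              linarith
    _ = _ := by
        rw [setLIntegral_const]
        ring

/-- The Jacobian in `y` degenerates as `s → 0`. For `s ≤ 1 / 2` the point on the segment is instead
viewed as a homothetic image of `x` with ratio `1 - s ≥ 1 / 2`, so the bound is uniform in `s`. -/
theorem lintegral_lintegral_comp_lineMap_le {k : E → ℝ≥0∞} (hk : Measurable k) {V : Set E}
    (hV : MeasurableSet V) (hc : Convex ℝ V) {s : ℝ} (hs : s ∈ Ioc (0 : ℝ) 1) :
    ∫⁻ x in V, ∫⁻ y in V, k (x + s • (y - x)) ≤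
      2 ^ finrank ℝ E * volume V * ∫⁻ y in V, k y := by
  rcases le_total (1 / 2) s with h | h
  · exact lintegral_lintegral_comp_lineMap_le_aux hk hV hc h hs.2
  · rw [lintegral_lintegral_swap (by fun_prop)]
    have : ∀ x y : E, x + s • (y - x) = y + (1 - s) • (x - y) := fun x y => by module
    simp only [this]
    exact lintegral_lintegral_comp_lineMap_le_aux hk hV hc (by linarith) (by linarith [hs.1])

/-- The segment estimate is integrated over all pairs of points, and Tonelli moves the segment
parameter outside. Working with pairs avoids any mean, and hence any normalization that would change
with the domain in the limit below. -/
theorem poincare_smooth {f : E → ℝ} (hf : ContDiff ℝ 1 f) {V : Set E} (hV : MeasurableSet V)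
    (hc : Convex ℝ V) {h : ℝ≥0∞} (hh : ∀ x ∈ V, ∀ y ∈ V, ‖y - x‖ₑ ≤ h) :
    ∫⁻ x in V, ∫⁻ y in V, ‖f x - f y‖ₑ ^ 2 ≤
      2 ^ finrank ℝ E * h ^ 2 * volume V * ∫⁻ x in V, ‖gradient f x‖ₑ ^ 2 := by
  have hg := (continuous_gradient hf).measurable
  have hk : Measurable fun x => ‖gradient f x‖ₑ ^ 2 := by fun_prop
  calc ∫⁻ x in V, ∫⁻ y in V, ‖f x - f y‖ₑ ^ 2
      ≤ ∫⁻ x in V, ∫⁻ y in V, h ^ 2 *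
          ∫⁻ s in Ioc (0 : ℝ) 1, ‖gradient f (x + s • (y - x))‖ₑ ^ 2 := by
        refine setLIntegral_mono' hV fun x hx => setLIntegral_mono' hV fun y hy => ?_
        refine (sq_enorm_sub_le_lintegral_gradient hf x y).trans ?_
        gcongr
        exact hh x hx y hy
    _ = h ^ 2 * ∫⁻ s in Ioc (0 : ℝ) 1, ∫⁻ x in V, ∫⁻ y in V,
          ‖gradient f (x + s • (y - x))‖ₑ ^ 2 := by
        have e1 : ∀ x : E, ∫⁻ y in V, h ^ 2 *
            ∫⁻ s in Ioc (0 : ℝ) 1, ‖gradient f (x + s • (y - x))‖ₑ ^ 2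
            = h ^ 2 * ∫⁻ s in Ioc (0 : ℝ) 1, ∫⁻ y in V, ‖gradient f (x + s • (y - x))‖ₑ ^ 2 := by
          intro x
          have m2 : Measurable fun p : E × ℝ =>
            ‖gradient f (x + p.2 • (p.1 - x))‖ₑ ^ 2 := by fun_prop
          rw [lintegral_const_mul _ m2.lintegral_prod_right', lintegral_lintegral_swap]
          exact m2.aemeasurable
        simp only [e1]
        have m3 : Measurable fun p : (E × ℝ) × E =>
            ‖gradient f (p.1.1 + p.1.2 • (p.2 - p.1.1))‖ₑ ^ 2 := by fun_prop
        have m4 := m3.lintegral_prod_right' (ν := volume.restrict V)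
        rw [lintegral_const_mul _ m4.lintegral_prod_right', lintegral_lintegral_swap]
        exact m4.aemeasurable
    _ ≤ h ^ 2 * ∫⁻ s in Ioc (0 : ℝ) 1, 2 ^ finrank ℝ E * volume V *
          ∫⁻ y in V, ‖gradient f y‖ₑ ^ 2 := by
        gcongr 1
        exact setLIntegral_mono' measurableSet_Ioc fun s hs =>
          lintegral_lintegral_comp_lineMap_le hk hV hc hs
    _ = _ := by
        rw [setLIntegral_const]
        simp
        ring

end Poincare

/-! ### Mollification: from smooth functions to weak gradients -/

section Mollification

open Module Filter Topology
open scoped Convolution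

variable {E : Type*} [NormedAddCommGroup E]

/-- The points whose closed ball of radius `r` stays in `U`. -/
def erosion (U : Set E) (r : ℝ) : Set E := {x | ∀ v : E, ‖v‖ ≤ r → x + v ∈ U}

theorem erosion_subset (U : Set E) {r : ℝ} (hr : 0 ≤ r) : erosion U r ⊆ U := fun x hx => by
  simpa using hx 0 (by simpa)

variable [InnerProductSpace ℝ E]

theorem convex_erosion {U : Set E} (hU : Convex ℝ U) (r : ℝ) : Convex ℝ (erosion U r) := by
  have : erosion U r = ⋂ v : E, ⋂ _ : ‖v‖ ≤ r, (fun x => x + v) ⁻¹' U := by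
    ext; simp [erosion]
  rw [this]
  exact convex_iInter₂ fun v _ => hU.translate_preimage_left v

variable [FiniteDimensional ℝ E]

theorem isOpen_erosion {U : Set E} (hU : IsOpen U) {r : ℝ} (hr : 0 ≤ r) :
    IsOpen (erosion U r) := by
  have : (erosion U r)ᶜ = Metric.cthickening r Uᶜ := by
    rw [hU.isClosed_compl.cthickening_eq_biUnion_closedBall hr]
    ext x
    simp only [erosion, mem_compl_iff, mem_ofPred_eq, not_forall, mem_iUnion, Metric.mem_closedBall,
      exists_prop]
    constructor
    · rintro ⟨v, hv, h⟩
      exact ⟨x + v, h, by simpa [dist_eq_norm] using hv⟩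
    · rintro ⟨y, hy, h⟩
      exact ⟨y - x, by rwa [← dist_eq_norm, dist_comm], by simpa using hy⟩
  rw [← isClosed_compl_iff, this]
  exact Metric.isClosed_cthickening

variable [MeasurableSpace E] [BorelSpace E]

/-- The mollification of `u`, extended by zero outside `U`. -/
def mollify (U : Set E) (φ : ContDiffBump (0 : E)) (u : E → ℝ) : E → ℝ :=
  φ.normed volume ⋆[ContinuousLinearMap.lsmul ℝ ℝ, volume] (U.indicator u)

/-- The probability measure with density `φ`. -/
def bumpMeasure (φ : ContDiffBump (0 : E)) : Measure E :=
  volume.withDensity fun y => ((φ.normed volume y).toNNReal : ℝ≥0∞)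

instance (φ : ContDiffBump (0 : E)) : IsProbabilityMeasure (bumpMeasure φ) := by
  constructor
  rw [bumpMeasure, withDensity_apply _ MeasurableSet.univ, Measure.restrict_univ]
  change ∫⁻ y, ENNReal.ofReal (φ.normed volume y) = 1
  rw [← ofReal_integral_eq_lintegral_ofReal φ.integrable_normed
    (Eventually.of_forall φ.nonneg_normed), φ.integral_normed, ENNReal.ofReal_one]

theorem integral_bumpMeasure {F : Type*} [NormedAddCommGroup F] [NormedSpace ℝ F]
    (φ : ContDiffBump (0 : E)) (f : E → F) :
    ∫ y, f y ∂(bumpMeasure φ) = ∫ y, φ.normed volume y • f y := by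
  rw [bumpMeasure, integral_withDensity_eq_integral_smul
    φ.continuous_normed.measurable.real_toNNReal]
  refine integral_congr_ae (Eventually.of_forall fun y => ?_)
  simp only [NNReal.smul_def, Real.coe_toNNReal _ (φ.nonneg_normed y)]

theorem locallyIntegrable_indicator {F : Type*} [NormedAddCommGroup F] {U : Set E}
    (hU : MeasurableSet U) (hUf : volume U ≠ ⊤)
    {u : E → F} (hu : MemLp u 2 (volume.restrict U)) : LocallyIntegrable (U.indicator u) := by
  have : IsFiniteMeasure (volume.restrict U) := ⟨by simpa using hUf.lt_top⟩
  exact ((integrable_indicator_iff hU).2 (hu.integrable (by norm_num))).locallyIntegrable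

theorem contDiff_mollify {U : Set E} (hU : MeasurableSet U) (hUf : volume U ≠ ⊤) {u : E → ℝ}
    (hu : MemLp u 2 (volume.restrict U)) (φ : ContDiffBump (0 : E)) :
    ContDiff ℝ 1 (mollify U φ u) :=
  φ.hasCompactSupport_normed.contDiff_convolution_left _ (n := 1) φ.contDiff_normed
    (locallyIntegrable_indicator hU hUf hu)

/-- For `x` in the erosion, `y ↦ ρ (x - y)` is itself a test function on `U`, so the weak gradient
identity applies to it. The result is written as an average over a probability measure so that
Jensen's inequality can be used. -/
theorem gradient_mollify {U : Set E} (hU : MeasurableSet U) (hUf : volume U ≠ ⊤) {u : E → ℝ}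
    (hu : MemLp u 2 (volume.restrict U)) {G : E → E}
    (hG : ∀ φ : E → ℝ, IsTestFunction U φ →
      ∫ x in U, u x • gradient φ x = - ∫ x in U, φ x • G x)
    (φ : ContDiffBump (0 : E)) {x : E} (hx : x ∈ erosion U φ.rOut) :
    gradient (mollify U φ u) x = ∫ y, U.indicator G (x - y) ∂(bumpMeasure φ) := by
  set ρ := φ.normed (volume : Measure E) with hρ
  have hρd : ContDiff ℝ ∞ ρ := φ.contDiff_normed
  have hρ1 : ContDiff ℝ 1 ρ := hρd.of_le (by simp)
  have hgr : ∀ y, gradient (fun y => ρ (x - y)) y = - gradient ρ (x - y) := fun y => by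
    have h1 : HasFDerivAt (fun y => ρ (x - y)) ((fderiv ℝ ρ (x - y)).comp
        (-ContinuousLinearMap.id ℝ E)) y :=
      ((hρ1.differentiable (by simp)) (x - y)).hasFDerivAt.comp y
        ((hasFDerivAt_id y).const_sub x)
    simp only [gradient, h1.fderiv, ← map_neg]
    congr 1
    ext v
    simp
  have htest : IsTestFunction U (fun y => ρ (x - y)) := by
    refine ⟨hρd.comp (contDiff_const.sub contDiff_id),
      φ.hasCompactSupport_normed.comp_homeomorph (Homeomorph.subLeft x), ?_⟩
    have hsub : tsupport (fun y => ρ (x - y)) ⊆ Metric.closedBall x φ.rOut := by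
      refine closure_minimal (fun y hy => ?_) Metric.isClosed_closedBall
      have : x - y ∈ Function.support ρ := hy
      rw [hρ, φ.support_normed_eq] at this
      rw [Metric.mem_closedBall', dist_eq_norm]
      exact (mem_ball_zero_iff.1 this).le
    refine hsub.trans fun y hy => ?_
    have := hx (y - x) (by simpa [dist_eq_norm] using hy)
    simpa using this
  have hloc := locallyIntegrable_indicator hU hUf hu
  set L : ℝ →L[ℝ] ℝ →L[ℝ] ℝ := ContinuousLinearMap.lsmul ℝ ℝ with hL
  have hD : HasFDerivAt (mollify U φ u) ((fderiv ℝ ρ ⋆[L.precompL E, volume] U.indicator u) x) x :=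
    φ.hasCompactSupport_normed.hasFDerivAt_convolution_left L hρ1 hloc x
  have hcg : Continuous (gradient ρ) := continuous_gradient hρ1
  have hsg : HasCompactSupport (gradient ρ) :=
    (φ.hasCompactSupport_normed.fderiv (𝕜 := ℝ)).comp_left
      (g := (InnerProductSpace.toDual ℝ _).symm) (map_zero _)
  have key : gradient (mollify U φ u) x = ∫ y, U.indicator u y • gradient ρ (x - y) := by
    refine ext_inner_left ℝ fun e => ?_
    have hint : Integrable fun y => U.indicator u y • gradient ρ (x - y) := by
      have := hsg.convolutionExists_left ((ContinuousLinearMap.lsmul ℝ ℝ).flip) hcg hloc x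
      exact this.integrable_swap
    have hsf : HasCompactSupport (fderiv ℝ ρ) := φ.hasCompactSupport_normed.fderiv (𝕜 := ℝ)
    have hint2 : Integrable fun y => (L.precompL E) (fderiv ℝ ρ (x - y)) (U.indicator u y) :=
      ConvolutionExistsAt.integrable_swap
        (hsf.convolutionExists_left (L.precompL E) (hρ1.continuous_fderiv (by simp)) hloc x)
    rw [← integral_inner hint e]
    have h1 : ⟪e, gradient (mollify U φ u) x⟫_ℝ = fderiv ℝ (mollify U φ u) x e := by
      rw [gradient, real_inner_comm, InnerProductSpace.toDual_symm_apply]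
    rw [h1, hD.fderiv, convolution_eq_swap, ContinuousLinearMap.integral_apply hint2]
    refine integral_congr_ae (Eventually.of_forall fun y => ?_)
    simp only [gradient]
    rw [real_inner_smul_right, real_inner_comm, InnerProductSpace.toDual_symm_apply]
    exact mul_comm _ _
  have h2 := hG _ htest
  simp only [hgr, smul_neg, integral_neg, neg_inj] at h2
  have e1 : ∫ y, U.indicator u y • gradient ρ (x - y) = ∫ y in U, u y • gradient ρ (x - y) := by
    rw [← integral_indicator hU]
    refine integral_congr_ae (Eventually.of_forall fun y => ?_)
    by_cases hy : y ∈ U <;> simp [hy]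
  rw [key, e1, h2, integral_bumpMeasure, ← integral_indicator hU,
    ← integral_sub_left_eq_self _ volume x]
  refine integral_congr_ae (Eventually.of_forall fun y => ?_)
  by_cases hy : x - y ∈ U <;> simp [hy, hρ]

/-- Jensen for the averaging measure, Tonelli and translation invariance. This uniform bound is
enough for the limit; convergence of the mollified gradients is not needed. -/
theorem lintegral_gradient_mollify_le {U : Set E} (hU : IsOpen U) (hUf : volume U ≠ ⊤)
    {u : E → ℝ} (hu : MemLp u 2 (volume.restrict U)) {G : E → E} (hGm : StronglyMeasurable G)
    (hG : ∀ φ : E → ℝ, IsTestFunction U φ →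
      ∫ x in U, u x • gradient φ x = - ∫ x in U, φ x • G x)
    (φ : ContDiffBump (0 : E)) :
    ∫⁻ x in erosion U φ.rOut, ‖gradient (mollify U φ u) x‖ₑ ^ 2 ≤ ∫⁻ x in U, ‖G x‖ₑ ^ 2 := by
  have hm : StronglyMeasurable (U.indicator G) := hGm.indicator hU.measurableSet
  calc ∫⁻ x in erosion U φ.rOut, ‖gradient (mollify U φ u) x‖ₑ ^ 2
      ≤ ∫⁻ x in erosion U φ.rOut, ∫⁻ y, ‖U.indicator G (x - y)‖ₑ ^ 2 ∂(bumpMeasure φ) := by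
        refine setLIntegral_mono' (isOpen_erosion hU φ.rOut_pos.le).measurableSet fun x hx => ?_
        rw [gradient_mollify hU.measurableSet hUf hu hG φ hx]
        exact sq_enorm_integral_le
          (hm.comp_measurable (measurable_const.sub measurable_id)).aestronglyMeasurable
    _ ≤ ∫⁻ x, ∫⁻ y, ‖U.indicator G (x - y)‖ₑ ^ 2 ∂(bumpMeasure φ) := setLIntegral_le_lintegral _ _
    _ = ∫⁻ y, (∫⁻ x, ‖U.indicator G (x - y)‖ₑ ^ 2) ∂(bumpMeasure φ) := by
        refine lintegral_lintegral_swap (μ := volume) (ν := bumpMeasure φ)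
          (f := fun x y => ‖U.indicator G (x - y)‖ₑ ^ 2)
          (Measurable.aemeasurable ?_)
        have h1 := (hm.comp_measurable (measurable_fst.sub measurable_snd : Measurable
          fun p : E × E => p.1 - p.2)).enorm
        exact h1.pow_const 2
    _ = ∫⁻ x in U, ‖G x‖ₑ ^ 2 := by
        have : ∀ y, ∫⁻ x, ‖U.indicator G (x - y)‖ₑ ^ 2 = ∫⁻ x in U, ‖G x‖ₑ ^ 2 := fun y => by
          rw [lintegral_sub_right_eq_self (μ := volume) (fun x => ‖U.indicator G x‖ₑ ^ 2) y,
            ← lintegral_indicator hU.measurableSet]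
          refine lintegral_congr fun x => ?_
          by_cases hx : x ∈ U
          · simp [hx]
          · simp [hx]
        simp only [this, lintegral_const, measure_univ, mul_one]

/-- The bump function on the ball of radius `1 / (n + 1)`. -/
def bumpSeq (E : Type*) [NormedAddCommGroup E] (n : ℕ) : ContDiffBump (0 : E) where
  rIn := 1 / (2 * (n + 1))
  rOut := 1 / (n + 1)
  rIn_pos := by positivity
  rIn_lt_rOut := by
    refine one_div_lt_one_div_of_lt (by positivity) ?_
    have : (0 : ℝ) ≤ n := n.cast_nonneg
    linarith

/-- The smooth inequality is applied on the erosions of `U`, which are again convex, and Fatou's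
lemma gives the limit: mollifications converge almost everywhere, and each pair of points of `U`
eventually lies in the erosions. -/
theorem poincare_double {U : Set E} (hU : IsOpen U) (hUf : volume U ≠ ⊤) (hc : Convex ℝ U)
    {h : ℝ≥0∞} (hh : ∀ x ∈ U, ∀ y ∈ U, ‖y - x‖ₑ ≤ h)
    {u : E → ℝ} (hum : StronglyMeasurable u) (hu : MemLp u 2 (volume.restrict U))
    {G : E → E} (hGm : StronglyMeasurable G)
    (hG : ∀ φ : E → ℝ, IsTestFunction U φ →
      ∫ x in U, u x • gradient φ x = - ∫ x in U, φ x • G x) :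
    ∫⁻ x in U, ∫⁻ y in U, ‖u x - u y‖ₑ ^ 2 ≤
      2 ^ finrank ℝ E * h ^ 2 * volume U * ∫⁻ x in U, ‖G x‖ₑ ^ 2 := by
  set μ := (volume : Measure E).restrict U with hμ
  set φ : ℕ → ContDiffBump (0 : E) := bumpSeq E with hφ
  set w : ℕ → E → ℝ := fun n => mollify U (φ n) u with hw
  set V : ℕ → Set E := fun n => erosion U (φ n).rOut with hV
  have hVo : ∀ n, IsOpen (V n) := fun n => isOpen_erosion hU (φ n).rOut_pos.le
  have hVU : ∀ n, V n ⊆ U := fun n => erosion_subset U (φ n).rOut_pos.le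
  have hwd : ∀ n, ContDiff ℝ 1 (w n) := fun n => contDiff_mollify hU.measurableSet hUf hu (φ n)
  have hr : Tendsto (fun n => (φ n).rOut) atTop (𝓝 0) := tendsto_one_div_add_atTop_nhds_zero_nat
  have hae : ∀ᵐ x, Tendsto (fun n => w n x) atTop (𝓝 (U.indicator u x)) := by
    refine ContDiffBump.ae_convolution_tendsto_right_of_locallyIntegrable (K := 2) hr ?_
      (locallyIntegrable_indicator hU.measurableSet hUf hu)
    -- The radii in `bumpSeq` have ratio exactly 2, which supplies the bounded ratio required for
    -- almost everywhere convergence.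
    refine Eventually.of_forall fun n => le_of_eq ?_
    simp only [hφ, bumpSeq]
    field_simp
  have hev : ∀ x ∈ U, ∀ᶠ n in atTop, x ∈ V n := by
    intro x hx
    obtain ⟨ε, hε, hb⟩ := Metric.isOpen_iff.1 hU x hx
    filter_upwards [hr.eventually (gt_mem_nhds hε)] with n hn v hv
    exact hb (by simpa [dist_eq_norm] using hv.trans_lt hn)
  have hae2 : ∀ᵐ x ∂μ, x ∈ U ∧ Tendsto (fun n => w n x) atTop (𝓝 (u x)) := by
    filter_upwards [ae_restrict_mem hU.measurableSet, ae_restrict_of_ae hae] with x hx hx2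
    rw [indicator_of_mem hx] at hx2
    exact ⟨hx, hx2⟩
  set F : ℕ → E × E → ℝ≥0∞ := fun n =>
    (V n ×ˢ V n).indicator fun p => ‖w n p.1 - w n p.2‖ₑ ^ 2 with hF
  have hwm : ∀ n, Measurable (w n) := fun n => (hwd n).continuous.measurable
  have hFm : ∀ n, Measurable (F n) := fun n => by
    have := hwm n
    refine Measurable.indicator ?_ ((hVo n).prod (hVo n)).measurableSet
    fun_prop
  have hlim : ∀ᵐ p ∂(μ.prod μ), ‖u p.1 - u p.2‖ₑ ^ 2 = liminf (fun n => F n p) atTop := by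
    filter_upwards [Measure.quasiMeasurePreserving_fst.ae hae2,
      Measure.quasiMeasurePreserving_snd.ae hae2] with p hp1 hp2
    refine (Tendsto.liminf_eq ?_).symm
    have ht : Tendsto (fun n => ‖w n p.1 - w n p.2‖ₑ ^ 2) atTop (𝓝 (‖u p.1 - u p.2‖ₑ ^ 2)) :=
      ((ENNReal.continuous_pow 2).tendsto _).comp
        ((continuous_enorm.tendsto _).comp (hp1.2.sub hp2.2))
    refine ht.congr' ?_
    filter_upwards [hev _ hp1.1, hev _ hp2.1] with n h1 h2
    rw [hF]
    simp only
    rw [indicator_of_mem (by exact ⟨h1, h2⟩)]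
  have hint : ∀ n, ∫⁻ p, F n p ∂(μ.prod μ) ≤
      2 ^ finrank ℝ E * h ^ 2 * volume U * ∫⁻ x in U, ‖G x‖ₑ ^ 2 := by
    intro n
    have hm2 : Measurable fun p : E × E => ‖w n p.1 - w n p.2‖ₑ ^ 2 := by
      have := hwm n
      fun_prop
    calc ∫⁻ p, F n p ∂(μ.prod μ) ≤ ∫⁻ p in V n ×ˢ V n, ‖w n p.1 - w n p.2‖ₑ ^ 2 := by
          rw [hF, lintegral_indicator ((hVo n).prod (hVo n)).measurableSet, Measure.volume_eq_prod]
          exact lintegral_mono' (Measure.restrict_mono subset_rfl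
            (Measure.prod_mono Measure.restrict_le_self Measure.restrict_le_self)) le_rfl
      _ = ∫⁻ x in V n, ∫⁻ y in V n, ‖w n x - w n y‖ₑ ^ 2 := by
          rw [Measure.volume_eq_prod, ← Measure.prod_restrict, lintegral_prod _ hm2.aemeasurable]
      _ ≤ 2 ^ finrank ℝ E * h ^ 2 * volume (V n) * ∫⁻ x in V n, ‖gradient (w n) x‖ₑ ^ 2 :=
          poincare_smooth (hwd n) (hVo n).measurableSet (convex_erosion hc _)
            fun x hx y hy => hh x (hVU n hx) y (hVU n hy)
      _ ≤ _ := by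
          gcongr 2 ^ finrank ℝ E * h ^ 2 * ?_ * ?_
          · exact measure_mono (hVU n)
          · exact lintegral_gradient_mollify_le hU hUf hu hGm hG (φ n)
  have hum' := hum.measurable
  rw [← lintegral_prod (μ := μ) (ν := μ) (fun p => ‖u p.1 - u p.2‖ₑ ^ 2)
    (by fun_prop : Measurable _).aemeasurable, lintegral_congr_ae hlim]
  refine (lintegral_liminf_le hFm).trans ?_
  exact (liminf_le_liminf (Eventually.of_forall hint)).trans_eq (liminf_const _)

/-- The Poincaré inequality on a bounded convex open set: `u` is close to a constant. -/
theorem exists_poincare_const {U : Set E} (hU : IsOpen U) (hUn : U.Nonempty) (hUf : volume U ≠ ⊤)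
    (hc : Convex ℝ U) {h : ℝ≥0∞} (hh : ∀ x ∈ U, ∀ y ∈ U, ‖y - x‖ₑ ≤ h)
    (u : Lp ℝ 2 ((volume : Measure E).restrict U)) (G : Lp E 2 ((volume : Measure E).restrict U))
    (hG : ∀ φ : E → ℝ, IsTestFunction U φ →
      ∫ x in U, u x • gradient φ x = - ∫ x in U, φ x • G x) :
    ∃ c : ℝ, ∫⁻ x in U, ‖u x - c‖ₑ ^ 2 ≤ 2 ^ finrank ℝ E * h ^ 2 * ∫⁻ x in U, ‖G x‖ₑ ^ 2 := by
  have hU0 : volume U ≠ 0 := (hU.measure_pos volume hUn).ne'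
  have h1 := poincare_double hU hUf hc hh (Lp.stronglyMeasurable u) (Lp.memLp u)
    (Lp.stronglyMeasurable G) hG
  have hum := (Lp.stronglyMeasurable u).measurable
  have hm : Measurable fun p : E × E => ‖u p.1 - u p.2‖ₑ ^ 2 := by fun_prop
  -- The constant is the value of `u` at a point where the inner integral does not exceed its
  -- average over `U`; dividing by the volume cancels the factor `volume U`.
  obtain ⟨x, -, hx⟩ := exists_le_setLAverage hU0 hUf
    (f := fun x => ∫⁻ y in U, ‖u x - u y‖ₑ ^ 2) hm.lintegral_prod_right'.aemeasurable
  refine ⟨u x, ?_⟩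
  have h2 : ∫⁻ y in U, ‖u y - u x‖ₑ ^ 2 = ∫⁻ y in U, ‖u x - u y‖ₑ ^ 2 := by
    refine lintegral_congr fun y => ?_
    rw [← enorm_neg, neg_sub]
  rw [h2]
  refine hx.trans ?_
  rw [setLAverage_eq]
  refine ENNReal.div_le_of_le_mul (h1.trans_eq ?_)
  ring

end Mollification

/-! ### Smooth functions and polynomials in `H¹` -/

section Smooth

variable {d : ℕ} {U : Set (EuclideanSpace ℝ (Fin d))}

theorem memLp_of_continuous_of_isBounded {F : Type*} [NormedAddCommGroup F]
    (hU : Bornology.IsBounded U) {f : EuclideanSpace ℝ (Fin d) → F} (hf : Continuous f) :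
    MemLp f 2 (volume.restrict U) := by
  have hK : IsCompact (closure U) := hU.isCompact_closure
  have : IsFiniteMeasure (volume.restrict (closure U)) := ⟨by simpa using hK.measure_lt_top⟩
  obtain ⟨C, hC⟩ := hK.exists_bound_of_continuousOn hf.continuousOn
  exact (MemLp.of_bound hf.aestronglyMeasurable C
    (ae_restrict_of_forall_mem hK.measurableSet hC)).mono_measure
    (Measure.restrict_mono subset_closure le_rfl)

/-- Since `φ` vanishes outside `U`, both integrals extend to the whole space, where integration by
parts needs no regularity of the boundary of `U`. -/
theorem integral_smul_gradient_test {f φ : EuclideanSpace ℝ (Fin d) → ℝ} (hf : ContDiff ℝ ∞ f)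
    (hφ : IsTestFunction U φ) :
    ∫ x in U, f x • gradient φ x = - ∫ x in U, φ x • gradient f x := by
  have hzero : ∀ x, x ∉ U → φ x = 0 := fun x hx =>
    image_eq_zero_of_notMem_tsupport fun h => hx (hφ.2.2 h)
  have hzero' : ∀ x, x ∉ U → gradient φ x = 0 := fun x hx => by
    have : fderiv ℝ φ x = 0 := by
      by_contra hne
      exact hx (hφ.2.2 (support_fderiv_subset ℝ hne))
    simp [gradient, this]
  rw [setIntegral_eq_integral_of_forall_compl_eq_zero (fun x hx => by simp [hzero' x hx]),
    setIntegral_eq_integral_of_forall_compl_eq_zero (fun x hx => by simp [hzero x hx])]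
  have hcf : Continuous f := hf.continuous
  have hcφ : Continuous φ := hφ.1.continuous
  have hcgf : Continuous (gradient f) := continuous_gradient (hf.of_le (by simp))
  have hcgφ := hφ.continuous_gradient
  have hsg := hφ.hasCompactSupport_gradient
  have i1 : Integrable fun x => f x • gradient φ x :=
    (hcf.smul hcgφ).integrable_of_hasCompactSupport hsg.smul_left
  have i2 : Integrable fun x => φ x • gradient f x :=
    (hcφ.smul hcgf).integrable_of_hasCompactSupport hφ.2.1.smul_right
  have hd : ∀ (g : EuclideanSpace ℝ (Fin d) → ℝ) (x e : EuclideanSpace ℝ (Fin d)),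
      fderiv ℝ g x e = ⟪e, gradient g x⟫_ℝ := fun g x e => by
    rw [real_inner_comm, gradient, InnerProductSpace.toDual_symm_apply]
  refine ext_inner_left ℝ fun e => ?_
  rw [inner_neg_right, ← integral_inner i1, ← integral_inner i2]
  have h := integral_mul_fderiv_eq_neg_fderiv_mul_of_integrable (μ := volume) (v := e)
    (f := f) (g := φ)
    (by
      simp only [hd]
      exact ((continuous_const.inner hcgf).mul hcφ).integrable_of_hasCompactSupport hφ.2.1.mul_left)
    (by
      simp only [hd]
      refine (hcf.mul (continuous_const.inner hcgφ)).integrable_of_hasCompactSupport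
        (HasCompactSupport.mul_left ?_)
      exact hsg.comp_left (g := fun y => ⟪e, y⟫_ℝ) (inner_zero_right _))
    ((hcf.mul hcφ).integrable_of_hasCompactSupport hφ.2.1.mul_left)
    (fun x _ => (hf.differentiable (by simp)) x) (fun x _ => hφ.differentiable x)
  simp only [hd] at h
  simp only [inner_smul_right]
  rw [h]
  congr 1
  exact integral_congr_ae (Filter.Eventually.of_forall fun x => mul_comm _ _)

/-- A smooth function as an element of `H¹(U)`, for bounded `U`. -/
def H1.ofSmooth (hU : Bornology.IsBounded U) (f : EuclideanSpace ℝ (Fin d) → ℝ)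
    (hf : ContDiff ℝ ∞ f) : H1 U :=
  ⟨WithLp.toLp 2 ((memLp_of_continuous_of_isBounded hU hf.continuous).toLp f,
    (memLp_of_continuous_of_isBounded hU
      (continuous_gradient (hf.of_le (by simp)))).toLp (gradient f)), by
    intro φ hφ
    have h1 := (memLp_of_continuous_of_isBounded hU hf.continuous).coeFn_toLp
    have h2 := (memLp_of_continuous_of_isBounded hU
      (continuous_gradient (hf.of_le (by simp) : ContDiff ℝ 1 f))).coeFn_toLp
    refine Eq.trans (integral_congr_ae ?_)
      ((integral_smul_gradient_test hf hφ).trans (congrArg _ (integral_congr_ae ?_)))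
    · filter_upwards [h1] with x hx
      exact congrArg (· • _) hx
    · filter_upwards [h2] with x hx
      exact (congrArg (φ x • ·) hx).symm⟩

theorem H1.isRepresentedBy_ofSmooth (hU : Bornology.IsBounded U)
    (f : EuclideanSpace ℝ (Fin d) → ℝ) (hf : ContDiff ℝ ∞ f) :
    H1.IsRepresentedBy (H1.ofSmooth hU f hf) f :=
  ⟨(memLp_of_continuous_of_isBounded hU hf.continuous).coeFn_toLp,
    (memLp_of_continuous_of_isBounded hU
      (continuous_gradient (hf.of_le (by simp) : ContDiff ℝ 1 f))).coeFn_toLp⟩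

theorem H1.IsRepresentedBy.unique {u v : H1 U} {f : EuclideanSpace ℝ (Fin d) → ℝ}
    (hu : H1.IsRepresentedBy u f) (hv : H1.IsRepresentedBy v f) : u = v :=
  Subtype.ext (congrArg (WithLp.toLp 2)
    (Prod.ext (Lp.ext (hu.1.trans hv.1.symm)) (Lp.ext (hu.2.trans hv.2.symm))))

theorem H1.isWeakGradient (u : H1 U) : IsWeakGradient U (H1.val u) (H1.grad u) := u.2

theorem locallyIntegrableOn_L2 {F : Type*} [NormedAddCommGroup F] (f : L2 U F) :
    LocallyIntegrableOn f U := by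
  have h : LocallyIntegrable f (volume.restrict U) := (Lp.memLp f).locallyIntegrable (by norm_num)
  exact locallyIntegrableOn_of_locallyIntegrable_restrict h

/-- An element of `H1` is a pair, so this is uniqueness of the weak gradient. It is needed because
membership in `polySpace` constrains only the `L²` component. -/
theorem H1.val_injective (hU : IsOpen U) : Function.Injective (H1.val (U := U)) := by
  rw [injective_iff_map_eq_zero]
  intro u hu
  have hg : H1.grad u = 0 := by
    refine Lp.ext ?_
    have h := hU.ae_eq_zero_of_integral_contDiff_smul_eq_zero
      (locallyIntegrableOn_L2 (H1.grad u)) fun φ h1 h2 h3 => ?_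
    · filter_upwards [Lp.coeFn_zero (EuclideanSpace ℝ (Fin d)) 2 (volume.restrict U),
        ae_restrict_of_ae h, ae_restrict_mem hU.measurableSet] with x hx h1 h2
      rw [hx, h1 h2, Pi.zero_apply]
    · have hφ : IsTestFunction U φ := ⟨h1, h2, h3⟩
      have h4 := H1.isWeakGradient u φ hφ
      rw [hu, integral_eq_zero_of_ae, eq_comm, neg_eq_zero] at h4
      · rw [← h4]
        refine (setIntegral_eq_integral_of_forall_compl_eq_zero fun x hx => ?_).symm
        rw [image_eq_zero_of_notMem_tsupport fun h => hx (hφ.2.2 h), zero_smul]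
      · filter_upwards [Lp.coeFn_zero ℝ 2 (volume.restrict U)] with x hx
        rw [hx]
        simp
  refine Subtype.ext ?_
  exact congrArg (WithLp.toLp 2) (Prod.ext hu hg)

/-- Test functions are elements of `H₀¹(U)`. -/
def H10.ofTest (hU : Bornology.IsBounded U) (φ : EuclideanSpace ℝ (Fin d) → ℝ)
    (hφ : IsTestFunction U φ) : H10 U :=
  ⟨H1.ofSmooth hU φ hφ.1,
    subset_closure ⟨φ, hφ, H1.isRepresentedBy_ofSmooth hU φ hφ.1⟩⟩

theorem H10.val_ofTest (hU : Bornology.IsBounded U) (φ : EuclideanSpace ℝ (Fin d) → ℝ)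
    (hφ : IsTestFunction U φ) :
    H1.val (H10.toH1 (H10.ofTest hU φ hφ)) =ᵐ[volume.restrict U] φ :=
  (H1.isRepresentedBy_ofSmooth hU φ hφ.1).1

theorem H10.grad_ofTest (hU : Bornology.IsBounded U) (φ : EuclideanSpace ℝ (Fin d) → ℝ)
    (hφ : IsTestFunction U φ) :
    H10.grad (H10.ofTest hU φ hφ) =ᵐ[volume.restrict U] gradient φ :=
  (H1.isRepresentedBy_ofSmooth hU φ hφ.1).2

/-- The function on `ℝᵈ` of a polynomial. -/
def polyFun (q : MvPolynomial (Fin d) ℝ) (x : EuclideanSpace ℝ (Fin d)) : ℝ :=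
  MvPolynomial.eval (fun i => x i) q

theorem contDiff_polyFun (q : MvPolynomial (Fin d) ℝ) {n : ℕ∞ω} : ContDiff ℝ n (polyFun q) := by
  induction q using MvPolynomial.induction_on with
  | C a =>
    have : polyFun (MvPolynomial.C a : MvPolynomial (Fin d) ℝ) = fun _ => a := by
      ext; simp [polyFun]
    rw [this]
    exact contDiff_const
  | add p q hp hq =>
    have : polyFun (p + q) = fun x => polyFun p x + polyFun q x := by ext; simp [polyFun]
    rw [this]
    exact hp.add hq
  | mul_X p i hp =>
    have : polyFun (p * MvPolynomial.X i) = fun x => polyFun p x * x i := by ext; simp [polyFun]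
    rw [this]
    exact hp.mul (EuclideanSpace.proj (𝕜 := ℝ) i).contDiff

/-- The polynomials of degree at most `ℓ` in `H¹(U)`, as a linear map of the polynomial. -/
def polyMap (ℓ : ℕ) (hU : Bornology.IsBounded U) :
    MvPolynomial.restrictTotalDegree (Fin d) ℝ ℓ →ₗ[ℝ] H1 U where
  toFun q := H1.ofSmooth hU (polyFun q.1) (contDiff_polyFun q.1)
  map_add' p q := by
    have h := (H1.isRepresentedBy_ofSmooth hU _ (contDiff_polyFun p.1)).add
      (H1.isRepresentedBy_ofSmooth hU _ (contDiff_polyFun q.1))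
      ((contDiff_polyFun (n := 1) _).differentiable (by simp))
      ((contDiff_polyFun (n := 1) _).differentiable (by simp))
    have e : polyFun (p.1 + q.1) = polyFun p.1 + polyFun q.1 := by ext; simp [polyFun]
    exact (H1.isRepresentedBy_ofSmooth hU _ (contDiff_polyFun (p.1 + q.1))).unique (e ▸ h)
  map_smul' c q := by
    have h := (H1.isRepresentedBy_ofSmooth hU _ (contDiff_polyFun q.1)).const_smul
      ((contDiff_polyFun (n := 1) _).differentiable (by simp)) c
    have e : polyFun (c • q.1) = c • polyFun q.1 := by ext; simp [polyFun]
    exact (H1.isRepresentedBy_ofSmooth hU _ (contDiff_polyFun (c • q.1))).unique (e ▸ h)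

theorem val_polyMap (ℓ : ℕ) (hU : Bornology.IsBounded U)
    (q : MvPolynomial.restrictTotalDegree (Fin d) ℝ ℓ) :
    H1.val (polyMap ℓ hU q) =ᵐ[volume.restrict U] polyFun q.1 :=
  (H1.isRepresentedBy_ofSmooth hU _ (contDiff_polyFun q.1)).1

/-- This gives the set of polynomials its linear structure and finite dimension. -/
theorem polySpace_eq_range (ℓ : ℕ) (hU : Bornology.IsBounded U) (hUo : IsOpen U) :
    polySpace ℓ U = LinearMap.range (polyMap ℓ hU) := by
  ext u
  constructor
  · rintro ⟨q, hq, hu⟩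
    refine ⟨⟨q, (MvPolynomial.mem_restrictTotalDegree _ _ _).2 hq⟩, H1.val_injective hUo ?_⟩
    exact Lp.ext ((val_polyMap ℓ hU _).trans hu.symm)
  · rintro ⟨q, rfl⟩
    exact ⟨q.1, (MvPolynomial.mem_restrictTotalDegree _ _ _).1 q.2, val_polyMap ℓ hU q⟩

/-- Polynomials of degree at most `ℓ` are stable under affine changes of variable. -/
theorem exists_polyFun_comp_affine (q : MvPolynomial (Fin d) ℝ) (c : EuclideanSpace ℝ (Fin d))
    (r : ℝ) : ∃ p : MvPolynomial (Fin d) ℝ, p.totalDegree ≤ q.totalDegree ∧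
      ∀ x, polyFun p x = polyFun q (r • (x - c)) := by
  set L : Fin d → MvPolynomial (Fin d) ℝ := fun i =>
    MvPolynomial.C r * (MvPolynomial.X i - MvPolynomial.C (c i)) with hL
  have hLd : ∀ i, (L i).totalDegree ≤ 1 := fun i => by
    refine (MvPolynomial.totalDegree_mul _ _).trans ?_
    rw [MvPolynomial.totalDegree_C, zero_add]
    refine (MvPolynomial.totalDegree_sub _ _).trans ?_
    simp
  refine ⟨∑ m ∈ q.support, MvPolynomial.C (q.coeff m) * ∏ i, L i ^ m i, ?_, fun x => ?_⟩
  · refine MvPolynomial.totalDegree_finsetSum_le fun m hm => ?_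
    refine (MvPolynomial.totalDegree_mul _ _).trans ?_
    rw [MvPolynomial.totalDegree_C, zero_add]
    refine (MvPolynomial.totalDegree_finsetProd _ _).trans ?_
    refine le_trans (Finset.sum_le_sum fun i _ => (MvPolynomial.totalDegree_pow _ _).trans
      (Nat.mul_le_mul_left _ (hLd i))) ?_
    simp only [mul_one]
    have := MvPolynomial.le_totalDegree hm
    rwa [Finsupp.sum_fintype _ _ (fun _ => rfl)] at this
  · simp only [polyFun, map_sum, map_mul, map_prod, map_pow, MvPolynomial.eval_C]
    rw [MvPolynomial.eval_eq']
    simp [hL]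

end Smooth

/-! ### Geometry of the cell -/

section Cell

variable {d : ℕ} {s : Affine.Simplex ℝ (EuclideanSpace ℝ (Fin d)) d}

theorem isOpen_cell : IsOpen (cell s) := isOpen_interior

theorem convex_cell : Convex ℝ (cell s) := (convex_convexHull ℝ _).interior

theorem volume_cell_ne_top : volume (cell s) ≠ ⊤ := (isBounded_cell s).measure_lt_top.ne

theorem isBounded_simplex (s : Affine.Simplex ℝ (EuclideanSpace ℝ (Fin d)) d) :
    Bornology.IsBounded (convexHull ℝ (range s.points)) :=
  isBounded_convexHull.2 (finite_range s.points).isBounded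

theorem dist_le_cellDiam {x y : EuclideanSpace ℝ (Fin d)} (hx : x ∈ convexHull ℝ (range s.points))
    (hy : y ∈ convexHull ℝ (range s.points)) : dist x y ≤ cellDiam s :=
  Metric.dist_le_diam_of_mem (isBounded_simplex s) hx hy

theorem cell_subset : cell s ⊆ convexHull ℝ (range s.points) := interior_subset

theorem enorm_sub_le_cellDiam {x y : EuclideanSpace ℝ (Fin d)} (hx : x ∈ cell s)
    (hy : y ∈ cell s) : ‖y - x‖ₑ ≤ ENNReal.ofReal (cellDiam s) := by
  rw [← ofReal_norm, ← dist_eq_norm]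
  exact ENNReal.ofReal_le_ofReal (dist_le_cellDiam (cell_subset hy) (cell_subset hx))

theorem cellDiam_pos (hd : 0 < d) (s : Affine.Simplex ℝ (EuclideanSpace ℝ (Fin d)) d) :
    0 < cellDiam s := by
  have h0 : s.points 0 ≠ s.points (Fin.last d) := by
    refine s.independent.injective.ne ?_
    simp [Fin.ext_iff]
    omega
  exact (dist_pos.2 h0).trans_le (dist_le_cellDiam (subset_convexHull ℝ _ (mem_range_self _))
    (subset_convexHull ℝ _ (mem_range_self _)))

/-- The dimension of a simplex is bounded by its shape regularity. -/
theorem IsShapeRegular.dim_lt {σ : ℝ} (hd : 0 < d) (hs : IsShapeRegular σ s) : (d : ℝ) + 1 ≤ σ := by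
  obtain ⟨c, ρ, hρ, hb, hh⟩ := hs
  have htop : affineSpan ℝ (range s.points) = ⊤ := by
    rw [s.independent.affineSpan_eq_top_iff_card_eq_finrank_add_one]
    simp
  let b : AffineBasis (Fin (d + 1)) ℝ (EuclideanSpace ℝ (Fin d)) := ⟨s.points, s.independent, htop⟩
  have hhull : convexHull ℝ (range s.points) = {x | ∀ i, 0 ≤ b.coord i x} :=
    b.convexHull_eq_nonneg_coord
  have hh0 := cellDiam_pos hd s
  have hσ : 0 < σ := by
    by_contra hcon
    nlinarith
  -- Moving from `c` by the distance `ρ` in the direction of an edge leaving vertex `i` stays in the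
  -- simplex and lowers the barycentric coordinate `i` by `ρ` over the edge length, hence by at
  -- least `1 / σ`. The coordinate stays nonnegative, so it was at least `1 / σ`; the `d + 1`
  -- coordinates sum to 1.
  have hcoord : ∀ i, 1 / σ ≤ b.coord i c := by
    intro i
    obtain ⟨j, hj⟩ : ∃ j : Fin (d + 1), j ≠ i := by
      have : Nontrivial (Fin (d + 1)) := Fin.nontrivial_iff_two_le.2 (by omega)
      exact exists_ne i
    set v := s.points j - s.points i with hv
    have hv0 : 0 < ‖v‖ := norm_pos_iff.2 (sub_ne_zero.2 (s.independent.injective.ne hj))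
    have hvh : ‖v‖ ≤ cellDiam s := by
      rw [hv, ← dist_eq_norm]
      exact dist_le_cellDiam (subset_convexHull ℝ _ (mem_range_self _))
        (subset_convexHull ℝ _ (mem_range_self _))
    have hlin : (b.coord i).linear v = -1 := by
      have h1 := (b.coord i).linearMap_vsub (s.points j) (s.points i)
      have h2 : b.coord i (s.points j) = 0 := b.coord_apply_ne hj.symm
      have h3 : b.coord i (s.points i) = 1 := b.coord_apply_eq i
      rw [vsub_eq_sub, h2, h3] at h1
      rw [hv, h1]
      simp
    have hmem : (ρ / ‖v‖) • v + c ∈ convexHull ℝ (range s.points) := by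
      refine hb ?_
      rw [Metric.mem_closedBall, dist_eq_norm, add_sub_cancel_right, norm_smul, Real.norm_eq_abs,
        abs_of_pos (by positivity), div_mul_cancel₀ _ hv0.ne']
    rw [hhull] at hmem
    have h4 := hmem i
    have h5 := (b.coord i).map_vadd c ((ρ / ‖v‖) • v)
    simp only [vadd_eq_add, map_smul, hlin, smul_eq_mul] at h5
    rw [h5] at h4
    have h6 : 1 / σ ≤ ρ / ‖v‖ := by
      rw [div_le_div_iff₀ hσ hv0]
      linarith
    linarith
  have hsum : ∑ i, b.coord i c = 1 := b.sum_coord_apply_eq_one c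
  have h7 : ∑ _i : Fin (d + 1), 1 / σ ≤ ∑ i, b.coord i c := Finset.sum_le_sum fun i _ => hcoord i
  rw [hsum, Finset.sum_const, Finset.card_univ, Fintype.card_fin, nsmul_eq_mul] at h7
  push_cast at h7
  rwa [mul_one_div, div_le_one hσ] at h7

end Cell

/-! ### Norms -/

section Norms

theorem sq_enorm_Lp {α F : Type*} [MeasurableSpace α] {μ : Measure α} [NormedAddCommGroup F]
    (f : Lp F 2 μ) : ‖f‖ₑ ^ 2 = ∫⁻ x, ‖f x‖ₑ ^ 2 ∂μ := by
  have := eLpNorm_nnreal_pow_eq_lintegral (f := f) (μ := μ) (p := 2) (by norm_num)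
  rw [Lp.enorm_def]
  simpa using this

/-- The iterated integral is the Bochner norm of `L²((a, b); L²(U))`. The estimates below are
carried out in the latter. -/
theorem normL2Cell_eq_eLpNorm {d : ℕ} {F : Type*} [NormedAddCommGroup F] (a b : ℝ)
    (U : Set (EuclideanSpace ℝ (Fin d))) (f : ℝ → L2 U F) :
    normL2Cell a b U (fun t => f t) = eLpNorm f 2 (volume.restrict (Ioo a b)) := by
  rw [normL2Cell, eLpNorm_eq_lintegral_rpow_enorm_toReal (by norm_num) (by norm_num)]
  simp only [← sq_enorm_Lp]
  simp

variable {d : ℕ} {s : Affine.Simplex ℝ (EuclideanSpace ℝ (Fin d)) d}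

theorem toLp_const_ae {U : Set (EuclideanSpace ℝ (Fin d))} (f : L2 U ℝ) (c : ℝ)
    [IsFiniteMeasure (volume.restrict U)] :
    (f - Lp.const 2 (volume.restrict U) c : L2 U ℝ) =ᵐ[volume.restrict U] fun x => f x - c := by
  filter_upwards [Lp.coeFn_sub f (Lp.const 2 (volume.restrict U) c),
    Lp.coeFn_const (p := 2) (μ := volume.restrict U) (c := c)] with x h1 h2
  rw [h1, Pi.sub_apply, h2, Function.const_apply]

instance : IsFiniteMeasure (volume.restrict (cell s)) :=
  ⟨by simpa using (volume_cell_ne_top (s := s)).lt_top⟩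

/-- The Poincaré inequality on the cell. -/
theorem exists_norm_sub_const_le (hne : (cell s).Nonempty) (u : H1 (cell s)) :
    ∃ c : ℝ, ‖H1.val u - Lp.const 2 (volume.restrict (cell s)) c‖ ≤
      2 ^ d * cellDiam s * ‖H1.grad u‖ := by
  obtain ⟨c, hc⟩ := exists_poincare_const isOpen_cell hne volume_cell_ne_top convex_cell
    (fun x hx y hy => enorm_sub_le_cellDiam hx hy) (H1.val u) (H1.grad u) (H1.isWeakGradient u)
  refine ⟨c, ?_⟩
  have h0 : 0 ≤ cellDiam s := Metric.diam_nonneg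
  have e : ∫⁻ x in cell s, ‖H1.val u x - c‖ₑ ^ 2 =
      ‖H1.val u - Lp.const 2 (volume.restrict (cell s)) c‖ₑ ^ 2 := by
    rw [sq_enorm_Lp]
    refine lintegral_congr_ae ?_
    filter_upwards [toLp_const_ae (H1.val u) c] with x hx
    rw [hx]
  rw [e, ← sq_enorm_Lp, ← ofReal_norm, ← ofReal_norm, finrank_euclideanSpace_fin] at hc
  have h2 : (2 : ℝ≥0∞) ^ d = ENNReal.ofReal (2 ^ d) := by
    rw [ENNReal.ofReal_pow (by norm_num), ENNReal.ofReal_ofNat]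
  rw [h2, ← ENNReal.ofReal_pow (by positivity),
    ← ENNReal.ofReal_pow (by positivity), ← ENNReal.ofReal_pow (by positivity),
    ← ENNReal.ofReal_mul (by positivity), ← ENNReal.ofReal_mul (by positivity),
    ENNReal.ofReal_le_ofReal_iff (by positivity)] at hc
  refine abs_le_of_sq_le_sq' (hc.trans ?_) (by positivity) |>.2
  rw [mul_pow, mul_pow]
  gcongr
  -- The squared inequality has the constant `2 ^ d`; enlarging it to `(2 ^ d) ^ 2` avoids a square
  -- root.
  exact le_self_pow₀ (one_le_pow₀ (by norm_num)) (by norm_num)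

end Norms

/-! ### Dual systems of polynomials and test functions -/

section DualSystem

variable {d : ℕ}

/-- The ball contains a cube, and a polynomial vanishing on a product of infinite sets is zero. -/
theorem polyFun_eq_zero_of_ball {q : MvPolynomial (Fin d) ℝ} {r : ℝ} (hr : 0 < r)
    (hq : ∀ x ∈ Metric.ball (0 : EuclideanSpace ℝ (Fin d)) r, polyFun q x = 0) : q = 0 := by
  have ho : IsOpen {y : Fin d → ℝ | WithLp.toLp 2 y ∈ Metric.ball (0 : EuclideanSpace ℝ (Fin d)) r} :=
    Metric.isOpen_ball.preimage (PiLp.continuous_toLp 2 _)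
  obtain ⟨ε, hε, hb⟩ := Metric.isOpen_iff.1 ho 0 (by simpa using hr)
  refine MvPolynomial.funext_set (fun _ => Metric.ball 0 ε)
    (fun _ => by rw [Real.ball_eq_Ioo]; exact Ioo_infinite (by linarith)) fun y hy => ?_
  have hy' : y ∈ Metric.ball (0 : Fin d → ℝ) ε := by
    rw [ball_pi _ hε]
    exact hy
  rw [map_zero]
  exact hq _ (hb hy')

/-- The bump function on the ball of radius `1 / 2`. -/
def refBump (d : ℕ) : ContDiffBump (0 : EuclideanSpace ℝ (Fin d)) where
  rIn := 1 / 4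
  rOut := 1 / 2
  rIn_pos := by norm_num
  rIn_lt_rOut := by norm_num

theorem integrable_refBump_mul {f : EuclideanSpace ℝ (Fin d) → ℝ} (hf : Continuous f) :
    Integrable fun x => refBump d x * f x :=
  ((refBump d).continuous.mul hf).integrable_of_hasCompactSupport
    (refBump d).hasCompactSupport.mul_right

theorem continuous_polyFun (q : MvPolynomial (Fin d) ℝ) : Continuous (polyFun q) :=
  (contDiff_polyFun (n := 0) q).continuous

theorem integrable_refBump_mul_polyFun (p q : MvPolynomial (Fin d) ℝ) :
    Integrable fun x => refBump d x * (polyFun p x * polyFun q x) :=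
  integrable_refBump_mul ((continuous_polyFun p).mul (continuous_polyFun q))

/-- The weighted `L²` product of polynomials. -/
def bumpForm (d ℓ : ℕ) : LinearMap.BilinForm ℝ (MvPolynomial.restrictTotalDegree (Fin d) ℝ ℓ) :=
  LinearMap.mk₂ ℝ (fun p q => ∫ x, refBump d x * (polyFun p.1 x * polyFun q.1 x))
    (fun p p' q => by
      rw [← integral_add (integrable_refBump_mul_polyFun _ _)
        (integrable_refBump_mul_polyFun _ _)]
      refine integral_congr_ae (Filter.Eventually.of_forall fun x => ?_)
      simp [polyFun]
      ring)
    (fun c p q => by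
      rw [smul_eq_mul, ← integral_const_mul]
      refine integral_congr_ae (Filter.Eventually.of_forall fun x => ?_)
      simp [polyFun]
      ring)
    (fun p q q' => by
      rw [← integral_add (integrable_refBump_mul_polyFun _ _)
        (integrable_refBump_mul_polyFun _ _)]
      refine integral_congr_ae (Filter.Eventually.of_forall fun x => ?_)
      simp [polyFun]
      ring)
    (fun c p q => by
      rw [smul_eq_mul, ← integral_const_mul]
      refine integral_congr_ae (Filter.Eventually.of_forall fun x => ?_)
      simp [polyFun]
      ring)

theorem bumpForm_apply {ℓ : ℕ} (p q : MvPolynomial.restrictTotalDegree (Fin d) ℝ ℓ) :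
    bumpForm d ℓ p q = ∫ x, refBump d x * (polyFun p.1 x * polyFun q.1 x) := rfl

/-- The integrand is continuous and nonnegative, hence identically zero, and the weight is positive
on the open ball of radius `1 / 2`. -/
theorem bumpForm_self {ℓ : ℕ} {p : MvPolynomial.restrictTotalDegree (Fin d) ℝ ℓ}
    (h : bumpForm d ℓ p p = 0) : p = 0 := by
  have hc : Continuous fun x => refBump d x * (polyFun p.1 x * polyFun p.1 x) :=
    (refBump d).continuous.mul ((continuous_polyFun _).mul (continuous_polyFun _))
  have h0 : ∀ x, 0 ≤ refBump d x * (polyFun p.1 x * polyFun p.1 x) := fun x =>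
    mul_nonneg (refBump d).nonneg (mul_self_nonneg _)
  have h1 := (integral_eq_zero_iff_of_nonneg h0 (integrable_refBump_mul_polyFun _ _)).1 h
  have h2 := (hc.ae_eq_iff_eq volume continuous_zero).1 h1
  refine Subtype.ext (polyFun_eq_zero_of_ball (r := 1 / 2) (by norm_num) fun x hx => ?_)
  have h3 := congrFun h2 x
  have h4 : 0 < refBump d x := (refBump d).pos_of_mem_ball hx
  simpa [h4.ne'] using h3

theorem bumpForm_nondegenerate (d ℓ : ℕ) : (bumpForm d ℓ).Nondegenerate :=
  ⟨fun p hp => bumpForm_self (hp p), fun p hp => bumpForm_self (hp p)⟩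

/-- A basis of the polynomials of degree at most `ℓ`. -/
def refBasis (d ℓ : ℕ) :
    Module.Basis (Fin (Module.finrank ℝ (MvPolynomial.restrictTotalDegree (Fin d) ℝ ℓ))) ℝ
      (MvPolynomial.restrictTotalDegree (Fin d) ℝ ℓ) :=
  Module.finBasis ℝ _

/-- The test functions dual to `refBasis`. -/
def refDual (d ℓ : ℕ) (j : Fin (Module.finrank ℝ (MvPolynomial.restrictTotalDegree (Fin d) ℝ ℓ)))
    (x : EuclideanSpace ℝ (Fin d)) : ℝ :=
  refBump d x *
    polyFun ((bumpForm d ℓ).dualBasis (bumpForm_nondegenerate d ℓ) (refBasis d ℓ) j).1 x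

theorem contDiff_refDual (d ℓ : ℕ) (j) : ContDiff ℝ ∞ (refDual d ℓ j) :=
  (refBump d).contDiff.mul (contDiff_polyFun _)

theorem support_refDual_subset (d ℓ : ℕ) (j) :
    Function.support (refDual d ℓ j) ⊆ Metric.closedBall 0 (1 / 2) := by
  refine (Function.support_mul_subset_left _ _).trans ?_
  rw [(refBump d).support_eq]
  exact Metric.ball_subset_closedBall

theorem hasCompactSupport_refDual (d ℓ : ℕ) (j) : HasCompactSupport (refDual d ℓ j) :=
  HasCompactSupport.of_support_subset_isCompact (isCompact_closedBall _ _)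
    (support_refDual_subset d ℓ j)

/-- This is the dual basis expansion for `bumpForm`. With the bump weight absorbed in `refDual`, the
coefficient functionals become integrals against smooth, compactly supported functions. -/
theorem polyFun_eq_sum_refBasis {ℓ : ℕ} (p : MvPolynomial.restrictTotalDegree (Fin d) ℝ ℓ)
    (x : EuclideanSpace ℝ (Fin d)) :
    polyFun p.1 x = ∑ j, (∫ y, polyFun p.1 y * refDual d ℓ j y) * polyFun (refBasis d ℓ j).1 x := by
  have h1 : ∀ j, ∫ y, polyFun p.1 y * refDual d ℓ j y = (refBasis d ℓ).repr p j := by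
    intro j
    have e : ∫ y, polyFun p.1 y * refDual d ℓ j y = bumpForm d ℓ
        ((bumpForm d ℓ).dualBasis (bumpForm_nondegenerate d ℓ) (refBasis d ℓ) j) p := by
      rw [bumpForm_apply]
      refine integral_congr_ae (Filter.Eventually.of_forall fun y => ?_)
      simp only [refDual]
      ring
    rw [e]
    conv_lhs => rw [← (refBasis d ℓ).sum_repr p]
    rw [map_sum]
    simp [LinearMap.BilinForm.apply_dualBasis_left]
  simp only [h1]
  have h2 := congrArg (fun r => polyFun r.1 x) ((refBasis d ℓ).sum_repr p)
  simp only [polyFun, Submodule.coe_sum, map_sum, Submodule.coe_smul, MvPolynomial.smul_eval] at h2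
  exact h2.symm

end DualSystem

/-! ### Transfer of the dual system to shape regular cells -/

section ScaledDualSystem

variable {d : ℕ}

/-- The radius is `σ` because a cell, translated to the centre of its inscribed ball and scaled by
`ρ⁻¹`, fits in the ball of radius `h_x / ρ ≤ σ`. -/
theorem exists_refBounds (d ℓ : ℕ) (σ : ℝ) : ∃ M : ℝ, 0 ≤ M ∧
    (∀ j, ∀ x ∈ Metric.closedBall (0 : EuclideanSpace ℝ (Fin d)) σ,
      ‖polyFun (refBasis d ℓ j).1 x‖ ≤ M) ∧
    (∀ j x, ‖refDual d ℓ j x‖ ≤ M) ∧ ∀ j x, ‖gradient (refDual d ℓ j) x‖ ≤ M := by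
  have h1 : ∀ j, ∃ M, ∀ x ∈ Metric.closedBall (0 : EuclideanSpace ℝ (Fin d)) σ,
      ‖polyFun (refBasis d ℓ j).1 x‖ ≤ M := fun j =>
    (isCompact_closedBall _ _).exists_bound_of_continuousOn (continuous_polyFun _).continuousOn
  have h2 : ∀ j, ∃ M, ∀ x, ‖refDual d ℓ j x‖ ≤ M := fun j =>
    (hasCompactSupport_refDual d ℓ j).exists_bound_of_continuous (contDiff_refDual d ℓ j).continuous
  have h3 : ∀ j, ∃ M, ∀ x, ‖gradient (refDual d ℓ j) x‖ ≤ M := fun j =>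
    ((hasCompactSupport_refDual d ℓ j).fderiv (𝕜 := ℝ) |>.comp_left
      (g := (InnerProductSpace.toDual ℝ _).symm) (map_zero _)).exists_bound_of_continuous
      (continuous_gradient ((contDiff_refDual d ℓ j).of_le (by simp)))
  choose M1 h1 using h1
  choose M2 h2 using h2
  choose M3 h3 using h3
  obtain ⟨A1, hA1⟩ := Finite.exists_le M1
  obtain ⟨A2, hA2⟩ := Finite.exists_le M2
  obtain ⟨A3, hA3⟩ := Finite.exists_le M3
  refine ⟨max 0 (max A1 (max A2 A3)), le_max_left _ _, fun j x hx => ?_, fun j x => ?_,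
    fun j x => ?_⟩
  · exact (h1 j x hx).trans ((hA1 j).trans (by simp))
  · exact (h2 j x).trans ((hA2 j).trans (by simp))
  · exact (h3 j x).trans ((hA3 j).trans (by simp))

theorem gradient_comp_affine {f : EuclideanSpace ℝ (Fin d) → ℝ} (hf : Differentiable ℝ f)
    (A r : ℝ) (c x : EuclideanSpace ℝ (Fin d)) :
    gradient (fun y => A * f (r • (y - c))) x = (A * r) • gradient f (r • (x - c)) := by
  have h1 : HasFDerivAt (fun y => r • (y - c)) (r • ContinuousLinearMap.id ℝ _) x :=
    ((hasFDerivAt_id x).sub_const c).const_smul r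
  have h2 : HasFDerivAt (fun y => A * f (r • (y - c)))
      (A • (fderiv ℝ f (r • (x - c))).comp (r • ContinuousLinearMap.id ℝ _)) x :=
    ((hf (r • (x - c))).hasFDerivAt.comp x h1).const_mul A
  rw [gradient, h2.fderiv, gradient]
  refine ext_inner_right ℝ fun e => ?_
  simp [inner_smul_left, mul_assoc]

theorem norm_L2_le_of_bound {U : Set (EuclideanSpace ℝ (Fin d))} {F : Type*}
    [NormedAddCommGroup F] [IsFiniteMeasure (volume.restrict U)] (hU : MeasurableSet U)
    {f : L2 U F} {g : EuclideanSpace ℝ (Fin d) → F} (hfg : f =ᵐ[volume.restrict U] g) {M : ℝ}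
    (hM : 0 ≤ M) (hg : ∀ x ∈ U, ‖g x‖ ≤ M) : ‖f‖ ≤ √(volume.real U) * M := by
  refine (Lp.norm_le_of_ae_bound hM ?_).trans_eq ?_
  · filter_upwards [hfg, ae_restrict_mem hU] with x h1 h2
    rw [h1]
    exact hg x h2
  · rw [Real.sqrt_eq_rpow]
    congr 1
    simp [measureUnivNNReal, measureReal_def, ENNReal.coe_toNNReal_eq_toReal]

/-- `q` is a system of polynomials of degree at most `ℓ` on the cell and `N` a system of test
functions dual to it, with the bounds expected from scaling. -/
structure IsDualSystem (ℓ : ℕ) (s : Affine.Simplex ℝ (EuclideanSpace ℝ (Fin d)) d) {n : ℕ}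
    (q : Fin n → H1 (cell s)) (N : Fin n → H10 (cell s)) (C : ℝ) : Prop where
  mem : ∀ j, q j ∈ polySpace ℓ (cell s)
  reproduce : ∀ u ∈ polySpace ℓ (cell s),
    H1.val u = ∑ j, ⟪H1.val u, H1.val (N j).toH1⟫_ℝ • H1.val (q j)
  bound_val : ∀ j, ‖H1.val (q j)‖ * ‖H1.val (N j).toH1‖ ≤ C
  bound_grad : ∀ j, ‖H1.val (q j)‖ * ‖N j‖ ≤ C / cellDiam s

set_option maxHeartbeats 1000000 in
/-- On shape regular cells there is a system of test functions dual to a basis of the polynomials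
of degree at most `ℓ`, with the bounds expected from scaling. -/
theorem exists_dualSystem (d ℓ : ℕ) (hd : 0 < d) (σ : ℝ) :
    ∃ (n : ℕ) (C : ℝ), 0 ≤ C ∧ ∀ s : Affine.Simplex ℝ (EuclideanSpace ℝ (Fin d)) d,
      IsShapeRegular σ s → ∃ (q : Fin n → H1 (cell s)) (N : Fin n → H10 (cell s)),
        IsDualSystem ℓ s q N C := by
  obtain ⟨M, hM, hM1, hM2, hM3⟩ := exists_refBounds d ℓ σ
  set κ := volume.real (Metric.ball (0 : EuclideanSpace ℝ (Fin d)) 1) with hκ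
  have hκ0 : 0 ≤ κ := measureReal_nonneg
  -- `M ^ 2` bounds the two reference functions, and `σ ^ d * κ` bounds the volume of the cell over
  -- `ρ ^ d`. The last factor serves both bounds: it is at least 1, and it exceeds `σ`, which
  -- converts `ρ⁻¹` into `σ / h_x`. Absolute values are needed until a cell shows that `σ` is
  -- positive.
  refine ⟨Module.finrank ℝ (MvPolynomial.restrictTotalDegree (Fin d) ℝ ℓ), M ^ 2 * (|σ| ^ d * κ) * (1 + |σ|),
    by positivity, fun s hs => ?_⟩
  have hσ : 0 < σ := by
    have := hs.dim_lt hd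
    linarith [(Nat.cast_nonneg d : (0 : ℝ) ≤ d)]
  rw [abs_of_pos hσ]
  obtain ⟨c, ρ, hρ, hb, hh⟩ := hs
  have hh0 := cellDiam_pos hd s
  have hc : c ∈ convexHull ℝ (range s.points) := hb (Metric.mem_closedBall_self hρ.le)
  have hball : Metric.ball c ρ ⊆ cell s :=
    interior_maximal (Metric.ball_subset_closedBall.trans hb) Metric.isOpen_ball
  have hT : ∀ x ∈ cell s, ρ⁻¹ • (x - c) ∈ Metric.closedBall (0 : EuclideanSpace ℝ (Fin d)) σ := by
    intro x hx
    rw [mem_closedBall_zero_iff, norm_smul, norm_inv, Real.norm_of_nonneg hρ.le, ← dist_eq_norm,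
      inv_mul_le_iff₀ hρ, mul_comm]
    exact (dist_le_cellDiam (cell_subset hx) hc).trans hh
  have hvol : volume.real (cell s) ≤ σ ^ d * κ * ρ ^ d := by
    have hsub : cell s ⊆ Metric.closedBall c (σ * ρ) := fun x hx =>
      (dist_le_cellDiam (cell_subset hx) hc).trans hh
    refine (measureReal_mono hsub (isBounded_iff_forall_norm_le.2
      ⟨‖c‖ + σ * ρ, fun x hx => ?_⟩).measure_lt_top.ne).trans_eq ?_
    · have := norm_le_norm_add_norm_sub' x c
      rw [Metric.mem_closedBall, dist_eq_norm] at hx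
      linarith
    · rw [measureReal_def, Measure.addHaar_closedBall _ _ (by positivity), ENNReal.toReal_mul,
        ENNReal.toReal_ofReal (by positivity), finrank_euclideanSpace_fin, hκ, measureReal_def]
      ring
  set Q := refBasis d ℓ with hQ
  set η := refDual d ℓ with hη
  -- Only a translation and a dilation are used, not an affine map to a reference simplex. `A`
  -- cancels the Jacobian of the dilation, so that duality is preserved.
  set A := (ρ ^ d)⁻¹ with hA
  have hA0 : 0 < A := by positivity
  choose P hPd hP using fun j => exists_polyFun_comp_affine (Q j).1 c ρ⁻¹
  have hηd : ∀ j, Differentiable ℝ (η j) := fun j =>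
    (contDiff_refDual d ℓ j).differentiable (by simp)
  have htest : ∀ j, IsTestFunction (cell s) fun x => A * η j (ρ⁻¹ • (x - c)) := by
    intro j
    have hsupp : Function.support (fun x => A * η j (ρ⁻¹ • (x - c))) ⊆
        Metric.closedBall c (ρ / 2) := by
      intro x hx
      have h1 := support_refDual_subset d ℓ j (right_ne_zero_of_mul hx)
      rw [mem_closedBall_zero_iff, norm_smul, norm_inv, Real.norm_of_nonneg hρ.le,
        inv_mul_le_iff₀ hρ] at h1
      rw [Metric.mem_closedBall, dist_eq_norm]
      linarith
    refine ⟨contDiff_const.mul ((contDiff_refDual d ℓ j).comp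
      ((contDiff_id.sub contDiff_const).const_smul _)),
      HasCompactSupport.of_support_subset_isCompact (isCompact_closedBall _ _) hsupp, ?_⟩
    refine (closure_minimal hsupp Metric.isClosed_closedBall).trans (Subset.trans ?_ hball)
    exact Metric.closedBall_subset_ball (by linarith)
  have hU := isBounded_cell s
  set q : _ → H1 (cell s) := fun j => H1.ofSmooth hU (polyFun (P j)) (contDiff_polyFun _) with hq
  set N : _ → H10 (cell s) := fun j => H10.ofTest hU _ (htest j) with hN
  have hqv : ∀ j, H1.val (q j) =ᵐ[volume.restrict (cell s)] polyFun (P j) := fun j =>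
    (H1.isRepresentedBy_ofSmooth hU _ (contDiff_polyFun (P j))).1
  have hqn : ∀ j, ‖H1.val (q j)‖ ≤ √(volume.real (cell s)) * M := fun j =>
    norm_L2_le_of_bound isOpen_cell.measurableSet (hqv j) hM fun x hx => by
      rw [hP]
      exact hM1 j _ (hT x hx)
  have hNv : ∀ j, ‖H1.val (N j).toH1‖ ≤ √(volume.real (cell s)) * (A * M) := fun j =>
    norm_L2_le_of_bound isOpen_cell.measurableSet (H10.val_ofTest hU _ (htest j)) (by positivity)
      fun x hx => by
        rw [norm_mul, Real.norm_of_nonneg hA0.le]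
        gcongr
        exact hM2 j _
  have hNg : ∀ j, ‖N j‖ ≤ √(volume.real (cell s)) * (A * ρ⁻¹ * M) := fun j =>
    norm_L2_le_of_bound isOpen_cell.measurableSet (H10.grad_ofTest hU _ (htest j)) (by positivity)
      fun x hx => by
        rw [gradient_comp_affine (hηd j), norm_smul, Real.norm_of_nonneg (by positivity)]
        gcongr
        exact hM3 j _
  have hvA : volume.real (cell s) * A ≤ σ ^ d * κ := by
    rw [hA, ← div_eq_mul_inv, div_le_iff₀ (by positivity)]
    exact hvol
  have hsq : √(volume.real (cell s)) * √(volume.real (cell s)) = volume.real (cell s) :=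
    Real.mul_self_sqrt measureReal_nonneg
  refine ⟨q, N, fun j => ⟨P j, (hPd j).trans ?_, hqv j⟩, ?_, fun j => ?_, fun j => ?_⟩
  · exact (MvPolynomial.mem_restrictTotalDegree _ _ _).1 (Q j).2
  · rintro u ⟨p, hp, hu⟩
    -- `p'` is `p` in reference coordinates, `p' y = p (ρ • y + c)`; in these coordinates the
    -- pairings are those of the reference system.
    obtain ⟨p', hp'd, hp'⟩ := exists_polyFun_comp_affine p (-(ρ⁻¹ • c)) ρ
    have hpp : ∀ x, polyFun p x = polyFun p' (ρ⁻¹ • (x - c)) := fun x => by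
      rw [hp']
      congr 1
      rw [sub_neg_eq_add, smul_add, smul_smul, smul_smul, mul_inv_cancel₀ hρ.ne']
      simp
    have hin : ∀ j, ⟪H1.val u, H1.val (N j).toH1⟫_ℝ = ∫ y, polyFun p' y * η j y := by
      intro j
      rw [L2.inner_def]
      calc ∫ x in cell s, ⟪H1.val u x, H1.val (N j).toH1 x⟫_ℝ
          = ∫ x in cell s, A * (polyFun p' (ρ⁻¹ • (x - c)) * η j (ρ⁻¹ • (x - c))) := by
            refine integral_congr_ae ?_
            filter_upwards [hu, H10.val_ofTest hU _ (htest j)] with x h1 h2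
            change H1.val u x = polyFun p x at h1
            rw [h2, h1, hpp]
            simp only [RCLike.inner_apply, conj_trivial]
            ring
        _ = ∫ x, A * (polyFun p' (ρ⁻¹ • (x - c)) * η j (ρ⁻¹ • (x - c))) := by
            refine setIntegral_eq_integral_of_forall_compl_eq_zero fun x hx => ?_
            have : A * η j (ρ⁻¹ • (x - c)) = 0 :=
              image_eq_zero_of_notMem_tsupport (f := fun x => A * η j (ρ⁻¹ • (x - c)))
                fun h => hx ((htest j).2.2 h)
            rw [mul_left_comm, this, mul_zero]
        _ = _ := by
            rw [integral_const_mul, integral_sub_right_eq_self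
              (fun x => polyFun p' (ρ⁻¹ • x) * η j (ρ⁻¹ • x)),
              Measure.integral_comp_inv_smul_of_nonneg volume
                (fun x => polyFun p' x * η j x) hρ.le, finrank_euclideanSpace_fin, smul_eq_mul,
              ← mul_assoc, hA, inv_mul_cancel₀ (by positivity), one_mul]
    refine Lp.ext (Filter.EventuallyEq.trans hu ?_)
    have hall : ∀ᵐ x ∂volume.restrict (cell s), ∀ j, H1.val (q j) x = polyFun (P j) x :=
      ae_all_iff.2 hqv
    have hsm : ∀ᵐ x ∂volume.restrict (cell s), ∀ j,
        (⟪H1.val u, H1.val (N j).toH1⟫_ℝ • H1.val (q j)) x =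
          ⟪H1.val u, H1.val (N j).toH1⟫_ℝ * H1.val (q j) x :=
      ae_all_iff.2 fun j => Lp.coeFn_smul _ _
    filter_upwards [hall, hsm, Lp.coeFn_finsetSum Finset.univ
      (fun j => ⟪H1.val u, H1.val (N j).toH1⟫_ℝ • H1.val (q j))] with x h1 h2 h3
    rw [h3, Finset.sum_apply]
    change polyFun p x = _
    rw [Finset.sum_congr rfl fun j _ => (h2 j).trans (by rw [h1 j, hin j, hP]), hpp]
    exact polyFun_eq_sum_refBasis
      ⟨p', (MvPolynomial.mem_restrictTotalDegree _ _ _).2 (hp'd.trans hp)⟩ _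
  · calc ‖H1.val (q j)‖ * ‖H1.val (N j).toH1‖
        ≤ (√(volume.real (cell s)) * M) * (√(volume.real (cell s)) * (A * M)) := by
          gcongr
          · exact hqn j
          · exact hNv j
      _ = M ^ 2 * ((√(volume.real (cell s)) * √(volume.real (cell s))) * A) := by ring
      _ ≤ M ^ 2 * (σ ^ d * κ) := by
          rw [hsq]
          gcongr
      _ ≤ _ := le_mul_of_one_le_right (by positivity) (by linarith)
  · calc ‖H1.val (q j)‖ * ‖N j‖
        ≤ (√(volume.real (cell s)) * M) * (√(volume.real (cell s)) * (A * ρ⁻¹ * M)) := by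
          gcongr
          · exact hqn j
          · exact hNg j
      _ = M ^ 2 * ((√(volume.real (cell s)) * √(volume.real (cell s))) * A) * ρ⁻¹ := by ring
      _ ≤ M ^ 2 * (σ ^ d * κ) * (σ / cellDiam s) := by
          rw [hsq]
          gcongr
          rw [inv_le_iff_one_le_mul₀ hρ, div_mul_eq_mul_div, one_le_div hh0]
          exact hh
      _ ≤ M ^ 2 * (σ ^ d * κ) * ((1 + σ) / cellDiam s) := by gcongr; linarith
      _ = _ := by ring

end ScaledDualSystem

/-! ### Quasi-interpolation in space -/

section Space

variable {d : ℕ} {s : Affine.Simplex ℝ (EuclideanSpace ℝ (Fin d)) d} {ℓ n : ℕ}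
  {q : Fin n → H1 (cell s)} {N : Fin n → H10 (cell s)} {C : ℝ}

/-- The linear quasi-interpolation of a dual system. -/
def quasiInterp (q : Fin n → H1 (cell s)) (N : Fin n → H10 (cell s)) :
    L2 (cell s) ℝ →L[ℝ] L2 (cell s) ℝ :=
  ∑ j, (innerSL ℝ (H1.val (N j).toH1)).smulRight (H1.val (q j))

theorem quasiInterp_apply (f : L2 (cell s) ℝ) :
    quasiInterp q N f = ∑ j, ⟪f, H1.val (N j).toH1⟫_ℝ • H1.val (q j) := by
  simp [quasiInterp, real_inner_comm]

theorem IsDualSystem.norm_quasiInterp_le (h : IsDualSystem ℓ s q N C) (f : L2 (cell s) ℝ) :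
    ‖quasiInterp q N f‖ ≤ n * C * ‖f‖ := by
  rw [quasiInterp_apply]
  refine (norm_sum_le _ _).trans ?_
  have : ∀ j ∈ Finset.univ, ‖⟪f, H1.val (N j).toH1⟫_ℝ • H1.val (q j)‖ ≤ C * ‖f‖ := fun j _ => by
    rw [norm_smul]
    calc ‖⟪f, H1.val (N j).toH1⟫_ℝ‖ * ‖H1.val (q j)‖
        ≤ (‖f‖ * ‖H1.val (N j).toH1‖) * ‖H1.val (q j)‖ := by
          gcongr
          exact norm_inner_le_norm _ _
      _ = (‖H1.val (q j)‖ * ‖H1.val (N j).toH1‖) * ‖f‖ := by ring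
      _ ≤ C * ‖f‖ := by
          gcongr
          exact h.bound_val j
  refine (Finset.sum_le_sum this).trans_eq ?_
  simp
  ring

theorem exists_mem_polySpace_const (ℓ : ℕ) (c : ℝ) :
    ∃ u ∈ polySpace ℓ (cell s), H1.val u = Lp.const 2 (volume.restrict (cell s)) c := by
  have hq : (MvPolynomial.C c : MvPolynomial (Fin d) ℝ).totalDegree ≤ ℓ := by simp
  refine ⟨polyMap ℓ (isBounded_cell s) ⟨_, (MvPolynomial.mem_restrictTotalDegree _ _ _).2 hq⟩,
    ⟨_, hq, val_polyMap _ _ _⟩, Lp.ext ?_⟩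
  refine (val_polyMap _ _ _).trans (Filter.EventuallyEq.trans ?_
    (Lp.coeFn_const (p := 2) (μ := volume.restrict (cell s)) (c := c)).symm)
  exact Filter.Eventually.of_forall fun x => by simp [polyFun]

/-- Quasi-interpolation fixes both `p` and constants, so the error of `u` equals that of `u - p`
minus its Poincaré constant; stability in `L²` then suffices. -/
theorem IsDualSystem.norm_sub_quasiInterp_le (h : IsDualSystem ℓ s q N C)
    (hne : (cell s).Nonempty) (hC : 0 ≤ C) (u : H1 (cell s)) {p : H1 (cell s)}
    (hp : p ∈ polySpace ℓ (cell s)) :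
    ‖H1.val u - quasiInterp q N (H1.val u)‖ ≤
      (1 + n * C) * 2 ^ d * cellDiam s * ‖H1.grad (u - p)‖ := by
  obtain ⟨c, hc⟩ := exists_norm_sub_const_le hne (u - p)
  obtain ⟨z, hz, hzc⟩ := exists_mem_polySpace_const (s := s) ℓ c
  rw [← hzc] at hc
  have e : H1.val u - quasiInterp q N (H1.val u) = (H1.val (u - p) - H1.val z) -
      quasiInterp q N (H1.val (u - p) - H1.val z) := by
    have h1 : quasiInterp q N (H1.val p) = H1.val p := by
      rw [quasiInterp_apply, ← h.reproduce p hp]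
    have h2 : quasiInterp q N (H1.val z) = H1.val z := by
      rw [quasiInterp_apply, ← h.reproduce z hz]
    simp only [map_sub, h1, h2]
    abel
  rw [e]
  calc _ ≤ ‖H1.val (u - p) - H1.val z‖ + n * C * ‖H1.val (u - p) - H1.val z‖ :=
        (norm_sub_le _ _).trans (by gcongr; exact h.norm_quasiInterp_le _)
    _ = (1 + n * C) * ‖H1.val (u - p) - H1.val z‖ := by ring
    _ ≤ (1 + n * C) * (2 ^ d * cellDiam s * ‖H1.grad (u - p)‖) := by gcongr
    _ = _ := by ring

end Space

/-! ### Weak time derivatives -/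

section Time

variable {a b : ℝ}

instance : IsFiniteMeasure (volume.restrict (Ioo a b)) := ⟨by simp⟩

theorem sq_eLpNorm_two {α F : Type*} [MeasurableSpace α] {μ : Measure α} [NormedAddCommGroup F]
    (f : α → F) : eLpNorm f 2 μ ^ 2 = ∫⁻ x, ‖f x‖ₑ ^ 2 ∂μ := by
  have := eLpNorm_nnreal_pow_eq_lintegral (f := f) (μ := μ) (p := 2) (by norm_num)
  simpa using this

/-- The interval is a convex set of dimension one, so `exists_poincare_const` applies with squared
constant `2 (b - a) ^ 2`, here enlarged to `4 (b - a) ^ 2`. -/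
theorem exists_time_poincare_const (hab : a < b) {f g : ℝ → ℝ} (hf : IsL2Time a b f)
    (hg : IsL2Time a b g) (hfg : IsWeakTimeDeriv a b f g) :
    ∃ c : ℝ, eLpNorm (fun t => f t - c) 2 (volume.restrict (Ioo a b)) ≤
      ENNReal.ofReal (2 * (b - a)) * eLpNorm g 2 (volume.restrict (Ioo a b)) := by
  have hw : ∀ φ : ℝ → ℝ, IsTestFunction (Ioo a b) φ →
      ∫ x in Ioo a b, hf.toLp f x • gradient φ x = - ∫ x in Ioo a b, φ x • hg.toLp g x := by
    intro φ hφ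
    have e1 : ∫ x in Ioo a b, hf.toLp f x • gradient φ x = ∫ t in Ioo a b, deriv φ t • f t := by
      refine integral_congr_ae ?_
      filter_upwards [hf.coeFn_toLp] with x hx
      rw [hx, gradient_eq_deriv', smul_eq_mul, smul_eq_mul, mul_comm]
    have e2 : ∫ x in Ioo a b, φ x • hg.toLp g x = ∫ t in Ioo a b, φ t • g t := by
      refine integral_congr_ae ?_
      filter_upwards [hg.coeFn_toLp] with x hx
      rw [hx]
    rw [e1, e2]
    exact hfg φ hφ
  obtain ⟨c, hc⟩ := exists_poincare_const isOpen_Ioo (nonempty_Ioo.2 hab) (by simp)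
    (convex_Ioo a b) (h := ENNReal.ofReal (b - a)) (fun x hx y hy => by
      rw [← ofReal_norm, Real.norm_eq_abs]
      refine ENNReal.ofReal_le_ofReal (abs_le.2 ⟨?_, ?_⟩) <;> linarith [hx.1, hx.2, hy.1, hy.2])
    (hf.toLp f) (hg.toLp g) hw
  refine ⟨c, ?_⟩
  have e1 : ∫⁻ x in Ioo a b, ‖hf.toLp f x - c‖ₑ ^ 2 =
      eLpNorm (fun t => f t - c) 2 (volume.restrict (Ioo a b)) ^ 2 := by
    rw [sq_eLpNorm_two]
    refine lintegral_congr_ae ?_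
    filter_upwards [hf.coeFn_toLp] with x hx
    rw [hx]
  have e2 : ∫⁻ x in Ioo a b, ‖hg.toLp g x‖ₑ ^ 2 =
      eLpNorm g 2 (volume.restrict (Ioo a b)) ^ 2 := by
    rw [sq_eLpNorm_two]
    refine lintegral_congr_ae ?_
    filter_upwards [hg.coeFn_toLp] with x hx
    rw [hx]
  rw [e1, e2, Module.finrank_self, pow_one] at hc
  refine (ENNReal.pow_le_pow_left_iff two_ne_zero).1 (hc.trans ?_)
  rw [mul_pow, ENNReal.ofReal_mul (by norm_num), mul_pow, ENNReal.ofReal_ofNat]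
  gcongr
  norm_num

variable {V : Type*} [NormedAddCommGroup V]

theorem isL2Time_of_continuous {p : ℝ → V} (hp : Continuous p) : IsL2Time a b p := by
  obtain ⟨C, hC⟩ := (isCompact_Icc (a := a) (b := b)).exists_bound_of_continuousOn hp.continuousOn
  exact MemLp.of_bound hp.aestronglyMeasurable C
    (ae_restrict_of_forall_mem measurableSet_Ioo fun x hx => hC x (Ioo_subset_Icc_self hx))

variable [NormedSpace ℝ V]

theorem IsTestFunction.integrable_smul_time {φ : ℝ → ℝ} (hφ : Continuous φ)
    (hs : HasCompactSupport φ) {f : ℝ → V} (hf : IsL2Time a b f) :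
    Integrable (fun t => φ t • f t) (volume.restrict (Ioo a b)) :=
  memLp_one_iff_integrable.1 (MemLp.smul (p := 2) (q := 2) hf
    ((hφ.memLp_of_hasCompactSupport hs).restrict _))

theorem IsTestFunction.continuous_deriv {U : Set ℝ} {φ : ℝ → ℝ} (hφ : IsTestFunction U φ) :
    Continuous (deriv φ) := hφ.1.continuous_deriv (by simp)

theorem IsWeakTimeDeriv.comp_clm [CompleteSpace V] {f g : ℝ → V} (hf : IsL2Time a b f)
    (hg : IsL2Time a b g) (h : IsWeakTimeDeriv a b f g) (L : V →L[ℝ] ℝ) :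
    IsWeakTimeDeriv a b (fun t => L (f t)) (fun t => L (g t)) := by
  intro φ hφ
  have h1 := congrArg L (h φ hφ)
  rw [map_neg, ← L.integral_comp_comm (IsTestFunction.integrable_smul_time hφ.continuous_deriv
    hφ.2.1.deriv hf), ← L.integral_comp_comm (IsTestFunction.integrable_smul_time
    hφ.1.continuous hφ.2.1 hg)] at h1
  simpa using h1

theorem IsTimePoly.continuous {k : ℕ} {S : Set V} {p : ℝ → V} (hp : IsTimePoly k S p) :
    Continuous p := by
  obtain ⟨c, -, hc⟩ := hp
  rw [funext hc]
  fun_prop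

theorem IsL2Time.comp_clm {W : Type*} [NormedAddCommGroup W] [NormedSpace ℝ W] {f : ℝ → V}
    (hf : IsL2Time a b f) (L : V →L[ℝ] W) : IsL2Time a b (fun t => L (f t)) :=
  L.comp_memLp' hf

end Time

/-! ### The approximation estimate -/

section Approximation

variable {d : ℕ} {s : Affine.Simplex ℝ (EuclideanSpace ℝ (Fin d)) d} {a b : ℝ}

theorem IsShapeRegular.cell_nonempty {σ : ℝ} (hs : IsShapeRegular σ s) : (cell s).Nonempty := by
  obtain ⟨c, ρ, hρ, hb, -⟩ := hs
  exact ⟨c, interior_maximal (Metric.ball_subset_closedBall.trans hb) Metric.isOpen_ball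
    (Metric.mem_ball_self hρ)⟩

/-- The integral error of the time-discretized coefficient against `w`. -/
theorem exists_coeff_const (hd : 0 < d) (hab : a < b) {v : ℝ → H1 (cell s)}
    (hv : IsL2Time a b v) {vt r : ℝ → HNeg (cell s)} (hvt : Continuous vt) (hr : IsL2Time a b r)
    (hw : IsWeakTimeDeriv a b (fun t => toHNeg hd (isBounded_cell s) (H1.val (v t)) - vt t) r)
    (w : H10 (cell s)) :
    ∃ c : ℝ, eLpNorm (fun t => ⟪H1.val (v t), H1.val w.toH1⟫_ℝ - vt t w - c) 2
        (volume.restrict (Ioo a b)) ≤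
      ENNReal.ofReal (2 * (b - a) * ‖w‖) * eLpNorm r 2 (volume.restrict (Ioo a b)) := by
  -- Evaluation at `w` turns the weak derivative in `H⁻¹` into a scalar one, bounded pointwise by
  -- `‖r t‖ ‖w‖`.
  set L : HNeg (cell s) →L[ℝ] ℝ := ContinuousLinearMap.apply ℝ ℝ w with hL
  have h1 : IsL2Time a b (fun t => toHNeg hd (isBounded_cell s) (H1.val (v t)) - vt t) :=
    ((hv.comp_clm H1.val).comp_clm (toHNeg hd (isBounded_cell s))).sub
      (isL2Time_of_continuous hvt)
  obtain ⟨c, hc⟩ := exists_time_poincare_const hab (h1.comp_clm L) (hr.comp_clm L)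
    (hw.comp_clm h1 hr L)
  refine ⟨c, hc.trans ?_⟩
  rw [ENNReal.ofReal_mul (p := 2 * (b - a)) (by linarith), mul_assoc]
  gcongr
  refine eLpNorm_le_mul_eLpNorm_of_ae_le_mul (Filter.Eventually.of_forall fun t => ?_) 2
  rw [mul_comm]
  exact (r t).le_opNorm w

variable {ℓ n : ℕ} {q : Fin n → H1 (cell s)} {N : Fin n → H10 (cell s)} {C : ℝ}

/-- The error splits into the spatial quasi-interpolation error and the error of replacing each
coefficient `⟨v t, N j⟩` by `vt t (N j) + c j`. Thus `vx` enters only the first part, and `vt` and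
`r` only the second. -/
theorem IsDualSystem.exists_approx (h : IsDualSystem ℓ s q N C) (hne : (cell s).Nonempty)
    (hC : 0 ≤ C) (hd : 0 < d) (hab : a < b) {k : ℕ} {v vx : ℝ → H1 (cell s)}
    (hv : IsL2Time a b v) (hvx : ∀ᵐ t ∂volume.restrict (Ioo a b), vx t ∈ polySpace ℓ (cell s))
    {vt r : ℝ → HNeg (cell s)} (hvt : IsTimePoly k univ vt) (hr : IsL2Time a b r)
    (hw : IsWeakTimeDeriv a b (fun t => toHNeg hd (isBounded_cell s) (H1.val (v t)) - vt t) r) :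
    ∃ vh : ℝ → H1 (cell s), IsTimePoly k (polySpace ℓ (cell s)) vh ∧
      eLpNorm (fun t => H1.val (v t - vh t)) 2 (volume.restrict (Ioo a b)) ≤
        ENNReal.ofReal ((1 + n * C) * 2 ^ d * cellDiam s) *
          eLpNorm (fun t => H1.grad (v t - vx t)) 2 (volume.restrict (Ioo a b)) +
        ENNReal.ofReal (2 * n * C * ((b - a) / cellDiam s)) *
          eLpNorm r 2 (volume.restrict (Ioo a b)) := by
  have hh0 := cellDiam_pos hd s
  set μ := volume.restrict (Ioo a b) with hμ
  choose c hc using fun j => exists_coeff_const hd hab hv hvt.continuous hr hw (N j)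
  have hvtc := hvt.continuous
  obtain ⟨ξ, -, hξ⟩ := hvt
  set vh : ℝ → H1 (cell s) := fun t => ∑ j, (vt t (N j) + c j) • q j with hvh
  have hpoly : IsTimePoly k (polySpace ℓ (cell s)) vh := by
    -- The constants `c j` belong to the coefficient of `t ^ 0`, so the degree `k` of `vt` is kept.
    refine ⟨fun i => ∑ j, (ξ i (N j) + if i = 0 then c j else 0) • q j, fun i => ?_, fun t => ?_⟩
    · have hm := h.mem
      rw [polySpace_eq_range ℓ (isBounded_cell s) isOpen_cell] at hm ⊢
      exact Submodule.sum_mem _ fun j _ => Submodule.smul_mem _ _ (hm j)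
    · simp only [hvh, Finset.smul_sum]
      rw [Finset.sum_comm]
      refine Finset.sum_congr rfl fun j _ => ?_
      simp only [smul_smul, ← Finset.sum_smul, mul_add]
      congr 1
      rw [Finset.sum_add_distrib, hξ]
      simp
  refine ⟨vh, hpoly, ?_⟩
  have hdecomp : (fun t => H1.val (v t - vh t)) =
      (fun t => H1.val (v t) - quasiInterp q N (H1.val (v t))) +
        ∑ j, fun t => (⟪H1.val (v t), H1.val (N j).toH1⟫_ℝ - vt t (N j) - c j) • H1.val (q j) := by
    ext1 t
    have hval : H1.val (vh t) = ∑ j, (vt t (N j) + c j) • H1.val (q j) := by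
      simp only [hvh, map_sum, map_smul]
    simp only [Pi.add_apply, Finset.sum_apply, quasiInterp_apply, map_sub, hval, sub_smul,
      add_smul, Finset.sum_sub_distrib, Finset.sum_add_distrib]
    abel
  have hvval : IsL2Time a b (fun t => H1.val (v t)) := hv.comp_clm H1.val
  have hm1 : AEStronglyMeasurable
      (fun t => H1.val (v t) - quasiInterp q N (H1.val (v t))) μ :=
    (hvval.sub (hvval.comp_clm (quasiInterp q N))).1
  have hm2 : ∀ j, AEStronglyMeasurable (fun t =>
      (⟪H1.val (v t), H1.val (N j).toH1⟫_ℝ - vt t (N j) - c j) • H1.val (q j)) μ := by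
    intro j
    have m1 : AEStronglyMeasurable (fun t => ⟪H1.val (v t), H1.val (N j).toH1⟫_ℝ) μ :=
      hvval.1.inner aestronglyMeasurable_const
    have m2 : Continuous fun t => vt t (N j) :=
      (ContinuousLinearMap.apply ℝ ℝ (N j)).continuous.comp hvtc
    exact ((m1.sub m2.aestronglyMeasurable).sub aestronglyMeasurable_const).smul
      aestronglyMeasurable_const
  rw [hdecomp]
  refine (eLpNorm_add_le hm1 (Finset.aestronglyMeasurable_sum _ fun j _ => hm2 j)
    (by norm_num)).trans (add_le_add ?_ ?_)
  · refine eLpNorm_le_mul_eLpNorm_of_ae_le_mul ?_ 2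
    filter_upwards [hvx] with t ht
    exact h.norm_sub_quasiInterp_le hne hC (v t) ht
  · refine (eLpNorm_sum_le (fun j _ => hm2 j) (by norm_num)).trans ?_
    have hj : ∀ j ∈ Finset.univ, eLpNorm (fun t =>
        (⟪H1.val (v t), H1.val (N j).toH1⟫_ℝ - vt t (N j) - c j) • H1.val (q j)) 2 μ ≤
        ENNReal.ofReal (2 * C * ((b - a) / cellDiam s)) * eLpNorm r 2 μ := by
      intro j _
      calc _ ≤ ENNReal.ofReal ‖H1.val (q j)‖ * eLpNorm (fun t =>
            ⟪H1.val (v t), H1.val (N j).toH1⟫_ℝ - vt t (N j) - c j) 2 μ := by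
            refine eLpNorm_le_mul_eLpNorm_of_ae_le_mul (Filter.Eventually.of_forall fun t => ?_) 2
            rw [norm_smul, mul_comm]
        _ ≤ ENNReal.ofReal ‖H1.val (q j)‖ *
            (ENNReal.ofReal (2 * (b - a) * ‖N j‖) * eLpNorm r 2 μ) := by
            gcongr
            exact hc j
        _ ≤ _ := by
            rw [← mul_assoc, ← ENNReal.ofReal_mul (norm_nonneg _)]
            refine mul_le_mul' (ENNReal.ofReal_le_ofReal ?_) le_rfl
            have hba : 0 ≤ b - a := by linarith
            calc ‖H1.val (q j)‖ * (2 * (b - a) * ‖N j‖)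
                = 2 * (b - a) * (‖H1.val (q j)‖ * ‖N j‖) := by ring
              _ ≤ 2 * (b - a) * (C / cellDiam s) := by
                gcongr
                exact h.bound_grad j
              _ = _ := by ring
    refine (Finset.sum_le_sum hj).trans_eq ?_
    rw [Finset.sum_const, Finset.card_univ, Fintype.card_fin, nsmul_eq_mul, ← mul_assoc,
      ← ENNReal.ofReal_natCast, ← ENNReal.ofReal_mul (Nat.cast_nonneg _)]
    congr 2
    ring

end Approximation

/-! ### The dual of a space with the parallelogram law -/

section Parallelogram

variable {E : Type*} [SeminormedAddCommGroup E] [NormedSpace ℝ E]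

/-- Testing with numbers `0 ≤ r ≤ f u` allows two applications in succession, which bound a sum of
two squared dual norms. -/
theorem sq_opNorm_le_of_forall {f : StrongDual ℝ E} {K : ℝ}
    (h : ∀ u : E, ‖u‖ ≤ 1 → ∀ r : ℝ, 0 ≤ r → r ≤ f u → r ^ 2 ≤ K) : ‖f‖ ^ 2 ≤ K := by
  have hK : 0 ≤ K := by simpa using h 0 (by simp) 0 le_rfl (by simp)
  rw [← Real.le_sqrt (norm_nonneg _) hK]
  have h1 : ∀ u : E, ‖u‖ ≤ 1 → ‖f u‖ ≤ √K := fun u hu => by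
    rw [Real.le_sqrt (norm_nonneg _) hK]
    rcases le_total 0 (f u) with h0 | h0
    · exact h u hu _ (norm_nonneg _) (by rw [Real.norm_of_nonneg h0])
    · exact h (-u) (by rwa [norm_neg]) _ (norm_nonneg _)
        (by rw [map_neg, Real.norm_of_nonpos h0])
  refine f.opNorm_le_bound' (Real.sqrt_nonneg K) fun x hx => ?_
  have h2 := h1 (‖x‖⁻¹ • x) (by rw [norm_smul, norm_inv, norm_norm, inv_mul_cancel₀ hx])
  rw [map_smul, norm_smul, norm_inv, norm_norm,
    inv_mul_le_iff₀ (lt_of_le_of_ne (norm_nonneg x) hx.symm)] at h2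
  linarith

/-- With `r` and `t` below the values of `ξ + ζ` at `u` and of `ξ - ζ` at `w`, `r² + t²` is at most
`ξ (r u + t w) + ζ (r u - t w)`. Cauchy–Schwarz in the plane and the parallelogram law in `E` give
`(r² + t²)² ≤ 2 (‖ξ‖² + ‖ζ‖²) (r² + t²)`. No completeness of `E` is involved. -/
theorem dual_parallelogram_le
    (hE : ∀ u w : E, ‖u + w‖ ^ 2 + ‖u - w‖ ^ 2 = 2 * (‖u‖ ^ 2 + ‖w‖ ^ 2)) (ξ ζ : StrongDual ℝ E) :
    ‖ξ + ζ‖ ^ 2 + ‖ξ - ζ‖ ^ 2 ≤ 2 * (‖ξ‖ ^ 2 + ‖ζ‖ ^ 2) := by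
  rw [← le_sub_iff_add_le]
  refine sq_opNorm_le_of_forall fun u hu r hr0 hr => ?_
  rw [le_sub_comm]
  refine sq_opNorm_le_of_forall fun w hw t ht0 ht => ?_
  rw [le_sub_iff_add_le]
  have h1 : r ^ 2 + t ^ 2 ≤ ‖ξ‖ * ‖r • u + t • w‖ + ‖ζ‖ * ‖r • u - t • w‖ := by
    calc r ^ 2 + t ^ 2 ≤ r * (ξ + ζ) u + t * (ξ - ζ) w := by
          nlinarith [mul_le_mul_of_nonneg_left hr hr0, mul_le_mul_of_nonneg_left ht ht0]
      _ = ξ (r • u + t • w) + ζ (r • u - t • w) := by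
          simp
          ring
      _ ≤ _ := add_le_add ((le_abs_self _).trans (ξ.le_opNorm _))
          ((le_abs_self _).trans (ζ.le_opNorm _))
  have h2 := hE (r • u) (t • w)
  have h3 : ‖r • u‖ ^ 2 ≤ r ^ 2 := by
    rw [norm_smul, Real.norm_of_nonneg hr0]
    exact pow_le_pow_left₀ (by positivity) (mul_le_of_le_one_right hr0 hu) 2
  have h4 : ‖t • w‖ ^ 2 ≤ t ^ 2 := by
    rw [norm_smul, Real.norm_of_nonneg ht0]
    exact pow_le_pow_left₀ (by positivity) (mul_le_of_le_one_right ht0 hw) 2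
  set X := ‖r • u + t • w‖
  set Y := ‖r • u - t • w‖
  set S := ‖ξ‖ ^ 2 + ‖ζ‖ ^ 2 with hS
  set m := r ^ 2 + t ^ 2 with hm
  have hm0 : 0 ≤ m := by positivity
  have h5 : m ^ 2 ≤ S * (2 * m) := by
    calc m ^ 2 ≤ (‖ξ‖ * X + ‖ζ‖ * Y) ^ 2 := pow_le_pow_left₀ hm0 h1 2
      _ ≤ S * (X ^ 2 + Y ^ 2) := by
          rw [hS]
          nlinarith [sq_nonneg (‖ξ‖ * Y - ‖ζ‖ * X)]
      _ ≤ S * (2 * m) := by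
          gcongr
          linarith
  rcases hm0.eq_or_lt with h0 | h0
  · have : t ^ 2 + r ^ 2 = 0 := by linarith
    rw [this]
    positivity
  · nlinarith

/-- The reverse inequality is the same one applied to `ξ + ζ` and `ξ - ζ`. -/
theorem dual_parallelogram
    (hE : ∀ u w : E, ‖u + w‖ ^ 2 + ‖u - w‖ ^ 2 = 2 * (‖u‖ ^ 2 + ‖w‖ ^ 2)) (ξ ζ : StrongDual ℝ E) :
    ‖ξ + ζ‖ * ‖ξ + ζ‖ + ‖ξ - ζ‖ * ‖ξ - ζ‖ = 2 * (‖ξ‖ * ‖ξ‖ + ‖ζ‖ * ‖ζ‖) := by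
  have h1 := dual_parallelogram_le hE ξ ζ
  have h2 := dual_parallelogram_le hE (ξ + ζ) (ξ - ζ)
  have e1 : (ξ + ζ) + (ξ - ζ) = (2 : ℝ) • ξ := by module
  have e2 : (ξ + ζ) - (ξ - ζ) = (2 : ℝ) • ζ := by module
  rw [e1, e2, norm_smul, norm_smul, Real.norm_ofNat] at h2
  nlinarith

end Parallelogram

/-! ### Polynomials in time with values in a Hilbert space -/

section TimePoly

variable {α : Type*} [MeasurableSpace α] {μ : Measure α}

/-- A scalar function times a vector. -/
def tens {V : Type*} [NormedAddCommGroup V] [NormedSpace ℝ V] :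
    V →L[ℝ] Lp ℝ 2 μ →L[ℝ] Lp V 2 μ :=
  ContinuousLinearMap.compLpL₂ 2 μ (ContinuousLinearMap.lsmul ℝ ℝ).flip

theorem coeFn_tens {V : Type*} [NormedAddCommGroup V] [NormedSpace ℝ V] (c : V) (f : Lp ℝ 2 μ) :
    tens c f =ᵐ[μ] fun t => f t • c :=
  ContinuousLinearMap.coeFn_compLp _ _

variable {V : Type*} [NormedAddCommGroup V] [InnerProductSpace ℝ V]

theorem inner_tens (c e : V) (f g : Lp ℝ 2 μ) :
    ⟪tens c f, tens e g⟫_ℝ = ⟪f, g⟫_ℝ * ⟪c, e⟫_ℝ := by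
  rw [L2.inner_def, L2.inner_def, ← integral_mul_const]
  refine integral_congr_ae ?_
  filter_upwards [coeFn_tens c f, coeFn_tens e g] with t h1 h2
  rw [h1, h2]
  simp [inner_smul_left, inner_smul_right]
  ring

theorem exists_nearest {H : Type*} [NormedAddCommGroup H] [InnerProductSpace ℝ H]
    (S : Submodule ℝ H) [S.HasOrthogonalProjection] (f : H) :
    ∃ p ∈ S, ∀ w ∈ S, ‖f - p‖ ≤ ‖f - w‖ := by
  refine ⟨S.starProjection f, S.starProjection_apply_mem f, fun w hw => ?_⟩
  rw [Submodule.starProjection_minimal]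
  exact ciInf_le ⟨0, by rintro _ ⟨x, rfl⟩; exact norm_nonneg _⟩ (⟨w, hw⟩ : S)

/-- Sums of scalar functions times vectors. -/
def tensSum {k : ℕ} (m : Fin k → Lp ℝ 2 μ) : (Fin k → V) →ₗ[ℝ] Lp V 2 μ where
  toFun c := ∑ i, tens (c i) (m i)
  map_add' c e := by simp [Finset.sum_add_distrib]
  map_smul' r c := by simp [Finset.smul_sum]

/-- Orthogonality of the scalar factors removes all mixed terms, whatever the vectors are; this
makes `tensSum e` an isometry. -/
theorem norm_sq_tensSum {k : ℕ} {e : Fin k → Lp ℝ 2 μ} (he : Orthonormal ℝ e) (c : Fin k → V) :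
    ‖tensSum e c‖ ^ 2 = ∑ j, ‖c j‖ ^ 2 := by
  have h0 : tensSum e c = ∑ j, tens (c j) (e j) := rfl
  rw [← real_inner_self_eq_norm_sq, h0, sum_inner]
  refine Finset.sum_congr rfl fun i _ => ?_
  rw [inner_sum, Finset.sum_eq_single i]
  · rw [inner_tens, real_inner_self_eq_norm_sq, he.1 i, one_pow, one_mul,
      real_inner_self_eq_norm_sq]
  · intro j _ hj
    rw [inner_tens, he.2 hj.symm, zero_mul]
  · simp

theorem tens_mem_range_tensSum {n : ℕ} (e : Fin n → Lp ℝ 2 μ) {g : Lp ℝ 2 μ}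
    (hg : g ∈ Submodule.span ℝ (range e)) (v : V) : tens v g ∈ LinearMap.range (tensSum (V := V) e) := by
  induction hg using Submodule.span_induction with
  | mem x hx =>
    obtain ⟨i, rfl⟩ := hx
    refine ⟨Pi.single i v, ?_⟩
    change ∑ j, tens ((Pi.single i v : Fin n → V) j) (e j) = _
    rw [Finset.sum_eq_single i]
    · simp
    · intro j _ hj
      simp [hj]
    · simp
  | zero => simp
  | add x y _ _ hx hy => rw [map_add]; exact Submodule.add_mem _ hx hy
  | smul r x _ hx => rw [map_smul]; exact Submodule.smul_mem _ _ hx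

theorem range_tensSum_le {k n : ℕ} {m : Fin k → Lp ℝ 2 μ} {e : Fin n → Lp ℝ 2 μ}
    (h : ∀ i, m i ∈ Submodule.span ℝ (range e)) :
    LinearMap.range (tensSum (V := V) m) ≤ LinearMap.range (tensSum (V := V) e) := by
  rintro _ ⟨c, rfl⟩
  have h0 : tensSum m c = ∑ i, tens (c i) (m i) := rfl
  rw [h0]
  exact Submodule.sum_mem _ fun i _ => tens_mem_range_tensSum e (h i) (c i)

theorem isComplete_range_tensSum_of_orthonormal [CompleteSpace V] {n : ℕ} {e : Fin n → Lp ℝ 2 μ}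
    (he : Orthonormal ℝ e) :
    IsComplete (LinearMap.range (tensSum (V := V) e) : Set (Lp V 2 μ)) := by
  set Φ : PiLp 2 (fun _ : Fin n => V) →ₗ[ℝ] Lp V 2 μ :=
    tensSum e ∘ₗ (WithLp.linearEquiv 2 ℝ (Fin n → V)).toLinearMap with hΦ
  have hiso : ∀ c, ‖Φ c‖ = ‖c‖ := by
    intro c
    refine (pow_left_inj₀ (norm_nonneg _) (norm_nonneg _) two_ne_zero).1 ?_
    rw [PiLp.norm_sq_eq_of_L2 (fun _ => V) c]
    exact norm_sq_tensSum he _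
  have hrange : LinearMap.range (tensSum (V := V) e) = LinearMap.range Φ :=
    (LinearEquiv.range_comp _ _).symm
  have h := (AddMonoidHomClass.isometry_of_norm Φ hiso).isUniformInducing.isComplete_range
  rw [hrange]
  exact h

/-- The range may be infinite-dimensional. It depends only on the span of `m`, so `m` can be
replaced by an orthonormal basis of that span, for which the range is an isometric image of a
complete space. -/
theorem isComplete_range_tensSum [CompleteSpace V] {k : ℕ} (m : Fin k → Lp ℝ 2 μ) :
    IsComplete (LinearMap.range (tensSum (V := V) m) : Set (Lp V 2 μ)) := by
  set M := Submodule.span ℝ (range m) with hM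
  have : FiniteDimensional ℝ M := FiniteDimensional.span_of_finite ℝ (finite_range m)
  set b := stdOrthonormalBasis ℝ M with hb
  set e : Fin (Module.finrank ℝ M) → Lp ℝ 2 μ := fun j => (b j : Lp ℝ 2 μ) with he
  have hspan : Submodule.span ℝ (range e) = M := by
    have h1 : range e = M.subtype '' range b := by
      rw [← range_comp]
      rfl
    have h2 : Submodule.span ℝ (range b) = ⊤ := by
      rw [← b.coe_toBasis]
      exact b.toBasis.span_eq
    rw [h1, Submodule.span_image, h2, Submodule.map_top, Submodule.range_subtype]
  have heq : LinearMap.range (tensSum (V := V) m) = LinearMap.range (tensSum (V := V) e) := by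
    refine le_antisymm (range_tensSum_le fun i => ?_) (range_tensSum_le fun j => (b j).2)
    rw [hspan]
    exact Submodule.subset_span (mem_range_self i)
  rw [heq]
  exact isComplete_range_tensSum_of_orthonormal (b.orthonormal.comp_linearIsometry M.subtypeₗᵢ)

end TimePoly

/-! ### Existence of the minima -/

section Minima

variable {a b : ℝ}

theorem isL2Time_pow (i : ℕ) : IsL2Time a b (fun t : ℝ => t ^ i) :=
  isL2Time_of_continuous (by fun_prop)

/-- The monomial `tⁱ` in `L²(a, b)`. -/
def mono (a b : ℝ) (i : ℕ) : Lp ℝ 2 (volume.restrict (Ioo a b)) :=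
  (isL2Time_pow i).toLp _

theorem coeFn_tensSum_mono {V : Type*} [NormedAddCommGroup V] [InnerProductSpace ℝ V] {k : ℕ}
    (c : Fin k → V) : tensSum (fun i : Fin k => mono a b i) c =ᵐ[volume.restrict (Ioo a b)]
      fun t => ∑ i : Fin k, t ^ (i : ℕ) • c i := by
  have h0 : tensSum (fun i : Fin k => mono a b i) c = ∑ i : Fin k, tens (c i) (mono a b i) := rfl
  rw [h0]
  have h1 : ∀ᵐ t ∂volume.restrict (Ioo a b), ∀ i : Fin k,
      tens (c i) (mono a b i) t = t ^ (i : ℕ) • c i := by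
    refine ae_all_iff.2 fun i => ?_
    filter_upwards [coeFn_tens (c i) (mono a b i), (isL2Time_pow (i : ℕ)).coeFn_toLp] with t h2 h3
    rw [h2]
    exact congrArg (· • c i) h3
  filter_upwards [h1, Lp.coeFn_finsetSum Finset.univ fun i : Fin k => tens (c i) (mono a b i)]
    with t h2 h3
  rw [h3, Finset.sum_apply]
  exact Finset.sum_congr rfl fun i _ => h2 i

theorem enorm_toLp_sub {V : Type*} [NormedAddCommGroup V] {g p : ℝ → V}
    (hg : IsL2Time a b g) {P : Lp V 2 (volume.restrict (Ioo a b))}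
    (hP : P =ᵐ[volume.restrict (Ioo a b)] p) :
    ‖hg.toLp g - P‖ₑ = eLpNorm (fun t => g t - p t) 2 (volume.restrict (Ioo a b)) := by
  rw [Lp.enorm_def]
  refine eLpNorm_congr_ae ?_
  filter_upwards [Lp.coeFn_sub (hg.toLp g) P, hg.coeFn_toLp, hP] with t h1 h2 h3
  rw [h1, Pi.sub_apply, h2, h3]

/-- Best approximation in `L²(a, b; V)` by polynomials in time, for a Hilbert space `V`. -/
theorem exists_best_timePoly {V : Type*} [NormedAddCommGroup V] [InnerProductSpace ℝ V]
    [CompleteSpace V] (k : ℕ) {g : ℝ → V} (hg : IsL2Time a b g) :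
    ∃ e : Fin k → V, ∀ c : Fin k → V,
      eLpNorm (fun t => g t - ∑ i : Fin k, t ^ (i : ℕ) • e i) 2 (volume.restrict (Ioo a b)) ≤
        eLpNorm (fun t => g t - ∑ i : Fin k, t ^ (i : ℕ) • c i) 2 (volume.restrict (Ioo a b)) := by
  set S := LinearMap.range (tensSum (V := V) fun i : Fin k => mono a b i) with hS
  have : CompleteSpace S := (isComplete_range_tensSum _).completeSpace_coe
  obtain ⟨_, ⟨e, rfl⟩, he⟩ := exists_nearest S (hg.toLp g)
  refine ⟨e, fun c => ?_⟩
  rw [← enorm_toLp_sub hg (coeFn_tensSum_mono e), ← enorm_toLp_sub hg (coeFn_tensSum_mono c),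
    ← ofReal_norm, ← ofReal_norm]
  exact ENNReal.ofReal_le_ofReal (he _ ⟨c, rfl⟩)

theorem H10.parallelogram {d : ℕ} {U : Set (EuclideanSpace ℝ (Fin d))} (u w : H10 U) :
    ‖u + w‖ ^ 2 + ‖u - w‖ ^ 2 = 2 * (‖u‖ ^ 2 + ‖w‖ ^ 2) := by
  have := parallelogram_law_with_norm ℝ (H10.grad u) (H10.grad w)
  simp only [H10.norm_def, map_add, map_sub]
  linarith

/-- The parallelogram law equips `HNeg U` with an inner product inducing the dual norm, and a dual
space is complete. -/
theorem exists_best_timePoly_HNeg {d : ℕ} {U : Set (EuclideanSpace ℝ (Fin d))} (k : ℕ)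
    {g : ℝ → HNeg U} (hg : IsL2Time a b g) :
    ∃ e : Fin k → HNeg U, ∀ c : Fin k → HNeg U,
      eLpNorm (fun t => g t - ∑ i : Fin k, t ^ (i : ℕ) • e i) 2 (volume.restrict (Ioo a b)) ≤
        eLpNorm (fun t => g t - ∑ i : Fin k, t ^ (i : ℕ) • c i) 2 (volume.restrict (Ioo a b)) :=
  @exists_best_timePoly a b (HNeg U) _
    (InnerProductSpace.ofNorm ℝ (dual_parallelogram H10.parallelogram)) _ k g hg

variable {V : Type*} [NormedAddCommGroup V] [NormedSpace ℝ V]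

theorem isWeakTimeDeriv_of_hasDerivAt {p p' : ℝ → V} (h : ∀ t, HasDerivAt p (p' t) t)
    (hp' : Continuous p') : IsWeakTimeDeriv a b p p' := by
  intro φ hφ
  have hp : Continuous p := continuous_iff_continuousAt.2 fun t => (h t).continuousAt
  have hd : ∀ t, t ∉ Ioo a b → deriv φ t = 0 := fun t ht => by
    by_contra hne
    exact ht (hφ.2.2 (support_deriv_subset hne))
  have h0 : ∀ t, t ∉ Ioo a b → φ t = 0 := fun t ht =>
    image_eq_zero_of_notMem_tsupport fun h => ht (hφ.2.2 h)
  rw [setIntegral_eq_integral_of_forall_compl_eq_zero (fun t ht => by rw [hd t ht, zero_smul]),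
    setIntegral_eq_integral_of_forall_compl_eq_zero (fun t ht => by rw [h0 t ht, zero_smul])]
  have key := integral_bilinear_hasDerivAt_right_eq_neg_left_of_integrable
    (L := ContinuousLinearMap.lsmul ℝ ℝ) (u := φ) (u' := deriv φ) (v := p) (v' := p')
    (fun t _ => ((hφ.1.differentiable (by simp)) t).hasDerivAt) (fun t _ => h t)
    ((hφ.1.continuous.smul hp').integrable_of_hasCompactSupport hφ.2.1.smul_right)
    ((hφ.continuous_deriv.smul hp).integrable_of_hasCompactSupport hφ.2.1.deriv.smul_right)
    ((hφ.1.continuous.smul hp).integrable_of_hasCompactSupport hφ.2.1.smul_right)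
  simp only [ContinuousLinearMap.lsmul_apply] at key
  rw [key, neg_neg]

theorem IsWeakTimeDeriv.sub {f g f' g' : ℝ → V} (hf : IsL2Time a b f) (hg : IsL2Time a b g)
    (hf' : IsL2Time a b f') (hg' : IsL2Time a b g') (h : IsWeakTimeDeriv a b f g)
    (h' : IsWeakTimeDeriv a b f' g') :
    IsWeakTimeDeriv a b (fun t => f t - f' t) (fun t => g t - g' t) := by
  intro φ hφ
  simp only [smul_sub]
  rw [integral_sub (IsTestFunction.integrable_smul_time hφ.continuous_deriv hφ.2.1.deriv hf)
    (IsTestFunction.integrable_smul_time hφ.continuous_deriv hφ.2.1.deriv hf'),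
    integral_sub (IsTestFunction.integrable_smul_time hφ.1.continuous hφ.2.1 hg)
    (IsTestFunction.integrable_smul_time hφ.1.continuous hφ.2.1 hg'), h φ hφ, h' φ hφ]
  abel

theorem IsWeakTimeDeriv.unique [CompleteSpace V] {f g g' : ℝ → V} (hg : IsL2Time a b g)
    (hg' : IsL2Time a b g') (h : IsWeakTimeDeriv a b f g) (h' : IsWeakTimeDeriv a b f g') :
    g =ᵐ[volume.restrict (Ioo a b)] g' := by
  have hloc : LocallyIntegrableOn (fun t => g t - g' t) (Ioo a b) :=
    (IntegrableOn.locallyIntegrableOn ((hg.sub hg').integrable (by norm_num)))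
  have h1 := isOpen_Ioo.ae_eq_zero_of_integral_contDiff_smul_eq_zero hloc fun φ h1 h2 h3 => by
    have hφ : IsTestFunction (Ioo a b) φ := ⟨h1, h2, h3⟩
    rw [← setIntegral_eq_integral_of_forall_compl_eq_zero (s := Ioo a b) fun t ht => by
      rw [image_eq_zero_of_notMem_tsupport fun h => ht (h3 h), zero_smul]]
    simp only [smul_sub]
    rw [integral_sub (IsTestFunction.integrable_smul_time hφ.1.continuous hφ.2.1 hg)
      (IsTestFunction.integrable_smul_time hφ.1.continuous hφ.2.1 hg'), sub_eq_zero,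
      ← neg_inj, ← h φ hφ, ← h' φ hφ]
  filter_upwards [ae_restrict_of_ae h1, ae_restrict_mem measurableSet_Ioo] with t h2 h3
  exact sub_eq_zero.1 (h2 h3)

theorem hasDerivAt_timePoly {k : ℕ} (c : ℕ → V) (t : ℝ) :
    HasDerivAt (fun t : ℝ => ∑ i ∈ Finset.range (k + 1), t ^ i • c i)
      (∑ i : Fin k, t ^ (i : ℕ) • (((i : ℕ) + 1 : ℝ) • c (i + 1))) t := by
  have h : ∀ i ∈ Finset.range (k + 1), HasDerivAt (fun t : ℝ => t ^ i • c i)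
      (((i : ℝ) * t ^ (i - 1)) • c i) t := fun i _ => (hasDerivAt_pow i t).smul_const (c i)
  refine (HasDerivAt.fun_sum h).congr_deriv ?_
  rw [Finset.sum_range_succ', Fin.sum_univ_eq_sum_range
    (fun i => t ^ i • (((i : ℝ) + 1) • c (i + 1)))]
  simp [smul_smul, mul_comm]

/-- Differentiation maps polynomials of degree at most `k` onto those with the `k` coefficients of
`t ^ 0, …, t ^ (k - 1)`. By uniqueness of weak derivatives the errors are therefore the distances of
`g` to the latter; for `k = 0` the only error is the norm of `g`. -/
theorem exists_isLeast_timeErrors {d : ℕ} (hd : 0 < d)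
    {s : Affine.Simplex ℝ (EuclideanSpace ℝ (Fin d)) d} (k : ℕ)
    {v : ℝ → H1 (cell s)} {g : ℝ → HNeg (cell s)} (h : IsParabolic hd a b s v g) :
    ∃ m, IsLeast (timeErrors hd k a b s v) m := by
  obtain ⟨hv, hg, hw⟩ := h
  have hV : IsL2Time a b (fun t => toHNeg hd (isBounded_cell s) (H1.val (v t))) :=
    (hv.comp_clm H1.val).comp_clm (toHNeg hd (isBounded_cell s))
  obtain ⟨e, he⟩ := exists_best_timePoly_HNeg k hg
  have hcont : ∀ c : Fin k → HNeg (cell s),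
      Continuous fun t : ℝ => ∑ i : Fin k, t ^ (i : ℕ) • c i := fun c => by fun_prop
  have hpoly : ∀ c : ℕ → HNeg (cell s), IsWeakTimeDeriv a b
      (fun t => toHNeg hd (isBounded_cell s) (H1.val (v t)) -
        ∑ i ∈ Finset.range (k + 1), t ^ i • c i)
      (fun t => g t - ∑ i : Fin k, t ^ (i : ℕ) • (((i : ℕ) + 1 : ℝ) • c (i + 1))) := fun c =>
    hw.sub hV hg (isL2Time_of_continuous (by fun_prop)) (isL2Time_of_continuous (hcont _))
      (isWeakTimeDeriv_of_hasDerivAt (hasDerivAt_timePoly c) (hcont _))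
  refine ⟨eLpNorm (fun t => g t - ∑ i : Fin k, t ^ (i : ℕ) • e i) 2 (volume.restrict (Ioo a b)),
    ⟨?_, ?_⟩⟩
  -- Coefficients of an antiderivative of the best approximation. The entry at index 0 is harmless:
  -- truncated subtraction makes it refer to `e 0`, but the factor `0⁻¹ = 0` annihilates it.
  · set c : ℕ → HNeg (cell s) := fun i =>
      if hi : i - 1 < k then (i : ℝ)⁻¹ • e ⟨i - 1, hi⟩ else 0 with hc
    refine ⟨fun t => ∑ i ∈ Finset.range (k + 1), t ^ i • c i,
      fun t => g t - ∑ i : Fin k, t ^ (i : ℕ) • e i,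
      ⟨c, fun _ => mem_univ _, fun _ => rfl⟩, hg.sub (isL2Time_of_continuous (hcont e)), ?_, rfl⟩
    have h1 := hpoly c
    have h2 : ∀ i : Fin k, ((i : ℕ) + 1 : ℝ) • c (i + 1) = e i := fun i => by
      have h3 : ((i : ℕ) : ℝ) + 1 ≠ 0 := by positivity
      simp [hc, smul_smul, h3]
    simpa only [h2] using h1
  · rintro _ ⟨vt, q, ⟨c, -, hc⟩, hq, hqw, rfl⟩
    have h1 : q =ᵐ[volume.restrict (Ioo a b)]
        fun t => g t - ∑ i : Fin k, t ^ (i : ℕ) • (((i : ℕ) + 1 : ℝ) • c (i + 1)) := by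
      refine IsWeakTimeDeriv.unique hq (hg.sub (isL2Time_of_continuous (hcont _))) hqw ?_
      simp only [hc]
      exact hpoly c
    rw [normL2Time, eLpNorm_congr_ae h1]
    exact he _

variable {d : ℕ} {s : Affine.Simplex ℝ (EuclideanSpace ℝ (Fin d)) d}

/-- The polynomials of degree at most `ℓ` as a subspace of `H¹`. -/
def polySubmodule (ℓ : ℕ) (s : Affine.Simplex ℝ (EuclideanSpace ℝ (Fin d)) d) :
    Submodule ℝ (H1 (cell s)) :=
  LinearMap.range (polyMap ℓ (isBounded_cell s))

theorem mem_polySubmodule {ℓ : ℕ} {u : H1 (cell s)} :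
    u ∈ polySubmodule ℓ s ↔ u ∈ polySpace ℓ (cell s) := by
  rw [polySpace_eq_range ℓ (isBounded_cell s) isOpen_cell]
  rfl

instance (ℓ : ℕ) : FiniteDimensional ℝ (polySubmodule ℓ s) :=
  inferInstanceAs (FiniteDimensional ℝ (LinearMap.range (polyMap ℓ (isBounded_cell s))))

/-- The competitors form the range of a linear map on a finite-dimensional space, so the orthogonal
projection in `L²((a, b); L²)` exists. -/
theorem exists_isLeast_polyErrors (k ℓ : ℕ) {v : ℝ → H1 (cell s)} (hv : IsL2Time a b v) :
    ∃ m, IsLeast (polyErrors k ℓ a b (cell s) v) m := by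
  have hV : IsL2Time a b (fun t => H1.val (v t)) := hv.comp_clm H1.val
  set T : (Fin (k + 1) → polySubmodule ℓ s) →ₗ[ℝ] Lp (L2 (cell s) ℝ) 2 (volume.restrict (Ioo a b)) :=
    tensSum (fun i : Fin (k + 1) => mono a b i) ∘ₗ
      (((H1.val (U := cell s)).toLinearMap ∘ₗ (polySubmodule ℓ s).subtype).compLeft (Fin (k + 1)))
    with hT
  have hTc : ∀ c, T c =ᵐ[volume.restrict (Ioo a b)]
      fun t => H1.val (∑ i : Fin (k + 1), t ^ (i : ℕ) • (c i : H1 (cell s))) := fun c => by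
    refine (coeFn_tensSum_mono _).trans (Filter.Eventually.of_forall fun t => ?_)
    simp [map_sum]
  obtain ⟨_, ⟨e, rfl⟩, he⟩ := exists_nearest (LinearMap.range T) (hV.toLp _)
  have hnorm : ∀ c, ‖hV.toLp _ - T c‖ₑ = normL2Cell a b (cell s) fun t =>
      H1.val (v t - ∑ i : Fin (k + 1), t ^ (i : ℕ) • (c i : H1 (cell s))) := fun c => by
    rw [enorm_toLp_sub hV (hTc c), normL2Cell_eq_eLpNorm]
    simp only [map_sub]
  refine ⟨‖hV.toLp _ - T e‖ₑ, ⟨?_, ?_⟩⟩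
  · refine ⟨fun t => ∑ i : Fin (k + 1), t ^ (i : ℕ) • (e i : H1 (cell s)),
      ⟨fun i => if hi : i < k + 1 then (e ⟨i, hi⟩ : H1 (cell s)) else 0, fun i => ?_, fun t => ?_⟩,
      hnorm e⟩
    · rw [← mem_polySubmodule]
      dsimp only
      split_ifs with hi
      · exact (e ⟨i, hi⟩).2
      · exact zero_mem _
    · rw [← Fin.sum_univ_eq_sum_range
        (fun i => t ^ i • if hi : i < k + 1 then (e ⟨i, hi⟩ : H1 (cell s)) else 0)]
      exact Finset.sum_congr rfl fun i _ => by rw [dif_pos i.2]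
  · rintro _ ⟨vh, ⟨c, hc, hvh⟩, rfl⟩
    have h2 := hnorm fun i => ⟨c i, mem_polySubmodule.2 (hc i)⟩
    have h1 : (fun t => H1.val (v t - vh t)) = fun t =>
        H1.val (v t - ∑ i : Fin (k + 1), t ^ (i : ℕ) • c i) := by
      ext1 t
      rw [hvh, ← Fin.sum_univ_eq_sum_range (fun i => t ^ i • c i)]
    have h3 : (normL2Cell a b (cell s) fun t => H1.val (v t - vh t)) =
        normL2Cell a b (cell s) fun t =>
          H1.val (v t - ∑ i : Fin (k + 1), t ^ (i : ℕ) • c i) :=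
      congrArg (fun f : ℝ → L2 (cell s) ℝ => normL2Cell a b (cell s) fun t => f t) h1
    rw [h3, ← h2]
    have h4 := he _ (LinearMap.mem_range_self T fun i => ⟨c i, mem_polySubmodule.2 (hc i)⟩)
    exact enorm_le_iff_norm_le.2 h4

/-- Best approximation of gradients by gradients of polynomials is linear. -/
theorem exists_gradProj (ℓ : ℕ) (s : Affine.Simplex ℝ (EuclideanSpace ℝ (Fin d)) d) :
    ∃ P : H1 (cell s) →L[ℝ] H1 (cell s), (∀ u, P u ∈ polySpace ℓ (cell s)) ∧
      ∀ u, ∀ p ∈ polySpace ℓ (cell s), ‖H1.grad (u - P u)‖ ≤ ‖H1.grad (u - p)‖ := by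
  set L : polySubmodule ℓ s →ₗ[ℝ] L2 (cell s) (EuclideanSpace ℝ (Fin d)) :=
    (H1.grad (U := cell s)).toLinearMap ∘ₗ (polySubmodule ℓ s).subtype with hL
  set R := LinearMap.range L with hR
  -- The gradient is not injective on polynomials, because of constants; a linear right inverse
  -- makes a choice of preimage, continuous by finite dimension.
  obtain ⟨G, hG⟩ := L.rangeRestrict.exists_rightInverse_of_surjective (LinearMap.range_rangeRestrict L)
  set Q : R →L[ℝ] H1 (cell s) := ((polySubmodule ℓ s).subtype ∘ₗ G).toContinuousLinearMap with hQ
  have hLG : ∀ r : R, H1.grad (Q r) = r := fun r => by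
    have h1 := LinearMap.congr_fun hG r
    exact congrArg Subtype.val h1
  refine ⟨Q ∘L R.orthogonalProjectionOnto ∘L H1.grad, fun u => ?_, fun u p hp => ?_⟩
  · rw [← mem_polySubmodule]
    exact (G _).2
  · rw [map_sub, map_sub]
    have h2 : H1.grad ((Q ∘L R.orthogonalProjectionOnto ∘L H1.grad) u) =
        R.starProjection (H1.grad u) := hLG _
    rw [h2, Submodule.starProjection_minimal]
    exact ciInf_le ⟨0, by rintro _ ⟨x, rfl⟩; exact norm_nonneg _⟩
      (⟨H1.grad p, ⟨⟨p, mem_polySubmodule.2 hp⟩, rfl⟩⟩ : R)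

/-- The minimization decouples in time. Since the pointwise minimizer is a continuous linear
function of `v t`, it is again in `L²` in time. -/
theorem exists_isLeast_spaceErrors (ℓ : ℕ) {v : ℝ → H1 (cell s)} (hv : IsL2Time a b v) :
    ∃ m, IsLeast (spaceErrors ℓ a b (cell s) v) m := by
  obtain ⟨P, hP, hmin⟩ := exists_gradProj ℓ s
  refine ⟨_, ⟨⟨fun t => P (v t), hv.comp_clm P, Filter.Eventually.of_forall fun t => hP _, rfl⟩, ?_⟩⟩
  rintro _ ⟨vx, -, hvx, rfl⟩
  rw [normL2Cell_eq_eLpNorm, normL2Cell_eq_eLpNorm]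
  refine eLpNorm_mono_ae ?_
  filter_upwards [hvx] with t ht
  exact hmin _ _ ht

end Minima

/-! ### The approximation estimate with a constant depending on the shape regularity only -/

section Main

/-- `C` is chosen before the dimension: it is a sum of the constants of all dimensions up to `⌈σ⌉₊`,
and shape regularity rules out the others. It does not depend on `k` either. -/
theorem exists_approx_uniform (ℓ : ℕ) (σ : ℝ) :
    ∃ C : ℝ≥0, ∀ (d : ℕ) (hd : 0 < d) (a b : ℝ) (_ : a < b)
      (s : Affine.Simplex ℝ (EuclideanSpace ℝ (Fin d)) d) (_ : IsShapeRegular σ s) (k : ℕ)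
      (v vx : ℝ → H1 (cell s)) (vt r : ℝ → HNeg (cell s)) (_ : IsL2Time a b v)
      (_ : ∀ᵐ t ∂volume.restrict (Ioo a b), vx t ∈ polySpace ℓ (cell s))
      (_ : IsTimePoly k univ vt) (_ : IsL2Time a b r)
      (_ : IsWeakTimeDeriv a b (fun t => toHNeg hd (isBounded_cell s) (H1.val (v t)) - vt t) r),
      ∃ vh, IsTimePoly k (polySpace ℓ (cell s)) vh ∧
        eLpNorm (fun t => H1.val (v t - vh t)) 2 (volume.restrict (Ioo a b)) ≤
          C * (ENNReal.ofReal (cellDiam s) *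
              eLpNorm (fun t => H1.grad (v t - vx t)) 2 (volume.restrict (Ioo a b)) +
            ENNReal.ofReal ((b - a) / cellDiam s) * eLpNorm r 2 (volume.restrict (Ioo a b))) := by
  have hex : ∀ d : ℕ, ∃ (n : ℕ) (C : ℝ), 0 ≤ C ∧ (0 < d →
      ∀ s : Affine.Simplex ℝ (EuclideanSpace ℝ (Fin d)) d, IsShapeRegular σ s →
        ∃ q N, IsDualSystem (n := n) ℓ s q N C) := fun d => by
    rcases Nat.eq_zero_or_pos d with rfl | hd
    · exact ⟨0, 0, le_rfl, fun h => absurd h (lt_irrefl 0)⟩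
    · obtain ⟨n, C, hC, h⟩ := exists_dualSystem d ℓ hd σ
      exact ⟨n, C, hC, fun _ => h⟩
  choose n C hC h using hex
  set A : ℕ → ℝ := fun d => (1 + n d * C d) * 2 ^ d + 2 * n d * C d with hA
  have hA1 : ∀ d, (1 + n d * C d) * 2 ^ d ≤ A d := fun d =>
    le_add_of_nonneg_right (mul_nonneg (by positivity) (hC d))
  have hA2 : ∀ d, 2 * n d * C d ≤ A d := fun d =>
    le_add_of_nonneg_left (mul_nonneg (add_nonneg zero_le_one
      (mul_nonneg (by positivity) (hC d))) (by positivity))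
  have hA0 : ∀ d, 0 ≤ A d := fun d => (mul_nonneg (by positivity) (hC d)).trans (hA2 d)
  refine ⟨(∑ d ∈ Finset.range (⌈σ⌉₊ + 1), A d).toNNReal, ?_⟩
  intro d hd a b hab s hs k v vx vt r hv hvx hvt hr hw
  have hdm : d ∈ Finset.range (⌈σ⌉₊ + 1) := by
    have h1 : (d : ℝ) ≤ ⌈σ⌉₊ := by linarith [hs.dim_lt hd, Nat.le_ceil σ]
    exact Finset.mem_range.2 (Nat.lt_succ_of_le (by exact_mod_cast h1))
  have hsum : A d ≤ ∑ d ∈ Finset.range (⌈σ⌉₊ + 1), A d :=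
    Finset.single_le_sum (fun i _ => hA0 i) hdm
  obtain ⟨q, N, hq⟩ := h d hd s hs
  obtain ⟨vh, hvh, hle⟩ := hq.exists_approx hs.cell_nonempty (hC d) hd hab hv hvx hvt hr hw
  refine ⟨vh, hvh, hle.trans ?_⟩
  have hh := cellDiam_pos hd s
  have hba : 0 ≤ (b - a) / cellDiam s := div_nonneg (by linarith) hh.le
  rw [mul_add, ← mul_assoc, ← mul_assoc]
  change _ ≤ ENNReal.ofReal _ * _ * _ + ENNReal.ofReal _ * _ * _
  rw [← ENNReal.ofReal_mul ((hA0 d).trans hsum), ← ENNReal.ofReal_mul ((hA0 d).trans hsum)]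
  gcongr
  · exact (hA1 d).trans hsum
  · exact (hA2 d).trans hsum

/-! ### Means -/

/-- Hölder between `L¹` and `L²`; the powers of the total mass cancel. -/
theorem eLpNorm_average_le {α : Type*} [MeasurableSpace α] {μ : Measure α} [IsFiniteMeasure μ]
    {f : α → ℝ} (hf : AEStronglyMeasurable f μ) :
    eLpNorm (fun _ : α => ⨍ y, f y ∂μ) 2 μ ≤ eLpNorm f 2 μ := by
  rcases eq_or_ne μ 0 with rfl | hμ
  · simp
  have h0 : μ univ ≠ 0 := by simpa using hμ
  have ht : μ univ ≠ ⊤ := measure_ne_top μ univ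
  rw [eLpNorm_const _ (by norm_num) hμ]
  have h1 : ‖⨍ y, f y ∂μ‖ₑ ≤ (μ univ)⁻¹ * eLpNorm f 1 μ := by
    rw [average_eq, enorm_smul, eLpNorm_one_eq_lintegral_enorm]
    gcongr
    · rw [measureReal_def, ← ENNReal.toReal_inv, Real.enorm_eq_ofReal ENNReal.toReal_nonneg]
      exact ENNReal.ofReal_toReal_le
    · exact enorm_integral_le_lintegral_enorm f
  have h2 := eLpNorm_le_eLpNorm_mul_rpow_measure_univ (p := 1) (q := 2) (by norm_num) hf
  calc ‖⨍ y, f y ∂μ‖ₑ * μ univ ^ (1 / (2 : ℝ≥0∞).toReal)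
      ≤ (μ univ)⁻¹ * (eLpNorm f 2 μ * μ univ ^ (1 / (1 : ℝ≥0∞).toReal - 1 / (2 : ℝ≥0∞).toReal)) *
        μ univ ^ (1 / (2 : ℝ≥0∞).toReal) := by
        gcongr
        exact h1.trans (by gcongr)
    _ = (μ univ)⁻¹ * (μ univ ^ (1 / (1 : ℝ≥0∞).toReal - 1 / (2 : ℝ≥0∞).toReal) *
        μ univ ^ (1 / (2 : ℝ≥0∞).toReal)) * eLpNorm f 2 μ := by ring
    _ = eLpNorm f 2 μ := by
        rw [← ENNReal.rpow_add _ _ h0 ht, sub_add_cancel]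
        simp [ENNReal.inv_mul_cancel h0 ht]

variable {d : ℕ} {s : Affine.Simplex ℝ (EuclideanSpace ℝ (Fin d)) d} {a b : ℝ}

/-- The spatial mean, as a continuous functional on `L²`. -/
theorem exists_clm_average (s : Affine.Simplex ℝ (EuclideanSpace ℝ (Fin d)) d) :
    ∃ A : L2 (cell s) ℝ →L[ℝ] ℝ, ∀ f : L2 (cell s) ℝ, A f = ⨍ x in cell s, f x := by
  refine ⟨(volume.real (cell s))⁻¹ •
    innerSL ℝ (Lp.const 2 (volume.restrict (cell s)) (1 : ℝ)), fun f => ?_⟩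
  rw [setAverage_eq]
  refine congrArg (fun y : ℝ => (volume.real (cell s))⁻¹ • y) ?_
  change ⟪Lp.const 2 (volume.restrict (cell s)) (1 : ℝ), f⟫_ℝ = _
  rw [L2.inner_def]
  refine integral_congr_ae ?_
  filter_upwards [Lp.coeFn_const (p := 2) (μ := volume.restrict (cell s)) (c := (1 : ℝ))] with x hx
  rw [hx]
  simp

theorem enorm_const_average_le (f : L2 (cell s) ℝ) :
    ‖Lp.const 2 (volume.restrict (cell s)) (⨍ x in cell s, f x)‖ₑ ≤ ‖f‖ₑ := by
  rw [Lp.enorm_def, Lp.enorm_def, eLpNorm_congr_ae (Lp.coeFn_const ..)]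
  exact eLpNorm_average_le (Lp.aestronglyMeasurable f)

/-- Subtracting the mean is, up to a factor of two, as good as subtracting any constant. -/
theorem normL2Cell_sub_cellMean_le (hne : (cell s).Nonempty) (hab : a < b) {w : ℝ → L2 (cell s) ℝ}
    (hw : IsL2Time a b w) (c : ℝ) :
    normL2Cell a b (cell s) (fun t x => w t x - cellMean a b (cell s) fun t x => w t x) ≤
      2 * eLpNorm (fun t => w t - Lp.const 2 (volume.restrict (cell s)) c) 2
        (volume.restrict (Ioo a b)) := by
  set μ := volume.restrict (Ioo a b)
  set ν := volume.restrict (cell s)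
  set m := cellMean a b (cell s) fun t x => w t x with hm
  obtain ⟨A, hA⟩ := exists_clm_average s
  have hν : NeZero ν := ⟨by
    rw [Ne, Measure.restrict_eq_zero]
    exact (isOpen_cell.measure_pos volume hne).ne'⟩
  have hμ : NeZero μ := ⟨by
    rw [Ne, Measure.restrict_eq_zero, Real.volume_Ioo]
    simpa using hab⟩
  have hA1 : ∀ y : ℝ, A (Lp.const 2 ν y) = y := fun y => by
    rw [hA, average_congr (Lp.coeFn_const ..)]
    exact average_const ν y
  set W : ℝ → L2 (cell s) ℝ := fun t => w t - Lp.const 2 ν c with hWdef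
  have hW : IsL2Time a b W := hw.sub (memLp_const _)
  have hAw : Integrable (fun t => A (w t)) μ := (hw.comp_clm A).integrable (by norm_num)
  -- Hence `w - m` is `W` minus its own mean, and the mean has norm at most that of `W`; this gives
  -- the factor 2.
  have hmean : ⨍ t, A (W t) ∂μ = m - c := by
    have h1 : ∀ t, A (W t) = A (w t) - c := fun t => by rw [hWdef, map_sub, hA1]
    simp only [h1]
    rw [average_eq, integral_sub hAw (integrable_const c), smul_sub, ← average_eq, ← average_eq,
      average_const, hm, cellMean]
    simp only [hA]
    rfl
  have hL : normL2Cell a b (cell s) (fun t x => w t x - m) =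
      eLpNorm (fun t => w t - Lp.const 2 ν m) 2 μ := by
    rw [← normL2Cell_eq_eLpNorm, normL2Cell, normL2Cell]
    congr 1
    refine lintegral_congr fun t => lintegral_congr_ae ?_
    filter_upwards [toLp_const_ae (w t) m] with x hx
    rw [hx]
  -- Averaging is a contraction first in time and then in space. Writing the norm of a constant `y`
  -- as `|y|` times the norm of 1 reduces the time average to scalar functions.
  have hconst : eLpNorm (fun _ : ℝ => Lp.const 2 ν (m - c)) 2 μ ≤ eLpNorm W 2 μ := by
    have h1 : ∀ y : ℝ, ‖Lp.const 2 ν y‖ₑ = ‖y * ‖Lp.const 2 ν (1 : ℝ)‖‖ₑ := fun y => by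
      rw [enorm_mul, enorm_norm, ← enorm_smul]
      congr 1
      have := (Lp.constL 2 ν ℝ (E := ℝ)).map_smul y 1
      simpa using this
    calc eLpNorm (fun _ : ℝ => Lp.const 2 ν (m - c)) 2 μ
        = eLpNorm (fun _ : ℝ => ⨍ t, A (W t) * ‖Lp.const 2 ν (1 : ℝ)‖ ∂μ) 2 μ := by
          refine eLpNorm_congr_enorm_ae (Filter.Eventually.of_forall fun t => ?_)
          rw [h1, ← hmean, average_eq, average_eq, integral_mul_const, smul_mul_assoc]
      _ ≤ eLpNorm (fun t => A (W t) * ‖Lp.const 2 ν (1 : ℝ)‖) 2 μ :=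
          eLpNorm_average_le ((hW.comp_clm A).aestronglyMeasurable.mul_const _)
      _ ≤ eLpNorm W 2 μ := by
          refine eLpNorm_mono_enorm fun t => ?_
          rw [← h1, hA]
          exact enorm_const_average_le (W t)
  rw [hL]
  calc eLpNorm (fun t => w t - Lp.const 2 ν m) 2 μ
      = eLpNorm (W - fun _ => Lp.const 2 ν (m - c)) 2 μ := by
        congr 1
        ext1 t
        have : Lp.const 2 ν (m - c) = Lp.const 2 ν m - Lp.const 2 ν c := map_sub (Lp.const 2 ν) m c
        simp only [hWdef, Pi.sub_apply, this]
        abel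
    _ ≤ eLpNorm W 2 μ + eLpNorm (fun _ : ℝ => Lp.const 2 ν (m - c)) 2 μ :=
        eLpNorm_sub_le hW.aestronglyMeasurable aestronglyMeasurable_const (by norm_num)
    _ ≤ 2 * eLpNorm W 2 μ := by
        rw [two_mul]
        gcongr

theorem exists_eq_const_of_mem_polySpace_zero {u : H1 (cell s)} (hu : u ∈ polySpace 0 (cell s)) :
    ∃ c : ℝ, H1.val u = Lp.const 2 (volume.restrict (cell s)) c := by
  obtain ⟨q, hq, hu⟩ := hu
  rw [Nat.le_zero, MvPolynomial.totalDegree_eq_zero_iff_eq_C] at hq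
  refine ⟨q.coeff 0, Lp.ext (hu.trans ?_)⟩
  rw [hq]
  simp only [MvPolynomial.eval_C, MvPolynomial.coeff_zero_C]
  exact (Lp.coeFn_const ..).symm

end Main

end ParabolicPoincare

open ParabolicPoincare
theorem mainTheorem4 :
    (∀ σ : ℝ, ∃ C : ℝ≥0, ∀ (d : ℕ) (hd : 0 < d) (a b : ℝ) (_ : a < b)
      (s : Affine.Simplex ℝ (EuclideanSpace ℝ (Fin d)) d) (_ : IsShapeRegular σ s)
      (v : ℝ → H1 (cell s)) (g : ℝ → HNeg (cell s)) (_ : IsParabolic hd a b s v g),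
      normL2Cell a b (cell s)
          (fun t x => H1.val (v t) x - cellMean a b (cell s) (fun t x => H1.val (v t) x))
        ≤ C * (ENNReal.ofReal (cellDiam s) * normL2Cell a b (cell s) (fun t => H1.grad (v t))
          + ENNReal.ofReal ((b - a) / cellDiam s) * normL2Time a b g)) ∧
    (∀ (k ℓ : ℕ) (σ : ℝ), ∃ C : ℝ≥0, ∀ (d : ℕ) (hd : 0 < d) (a b : ℝ) (_ : a < b)
      (s : Affine.Simplex ℝ (EuclideanSpace ℝ (Fin d)) d) (_ : IsShapeRegular σ s)
      (v : ℝ → H1 (cell s)) (g : ℝ → HNeg (cell s)) (_ : IsParabolic hd a b s v g),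
      ∃ m mx mt : ℝ≥0∞,
        IsLeast (polyErrors k ℓ a b (cell s) v) m ∧
        IsLeast (spaceErrors ℓ a b (cell s) v) mx ∧
        IsLeast (timeErrors hd k a b s v) mt ∧
        m ≤ C * (ENNReal.ofReal (cellDiam s) * mx
          + ENNReal.ofReal ((b - a) / cellDiam s) * mt)) := by
  refine ⟨fun σ => ?_, fun k ℓ σ => ?_⟩
  · obtain ⟨C, hC⟩ := exists_approx_uniform 0 σ
    refine ⟨2 * C, fun d hd a b hab s hs v g ⟨hv, hg, hw⟩ => ?_⟩
    -- With `k = ℓ = 0` and `vx = vt = 0` the approximant is constant in time and space.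
    obtain ⟨vh, ⟨p, hp, hvh⟩, hle⟩ := hC d hd a b hab s hs 0 v 0 0 g hv
      (Filter.Eventually.of_forall fun _ => mem_polySubmodule.1 (zero_mem _))
      ⟨0, fun _ => mem_univ _, fun t => by simp⟩ hg (by simpa using hw)
    obtain ⟨c, hc⟩ := exists_eq_const_of_mem_polySpace_zero (hp 0)
    refine (normL2Cell_sub_cellMean_le hs.cell_nonempty hab (hv.comp_clm H1.val) c).trans ?_
    have h1 : (fun t => H1.val (v t - vh t)) =
        fun t => H1.val (v t) - Lp.const 2 (volume.restrict (cell s)) c := by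
      ext1 t
      simp [hvh, hc]
    rw [h1] at hle
    rw [normL2Cell_eq_eLpNorm, ENNReal.coe_mul, mul_assoc]
    exact mul_le_mul_right (by simpa [normL2Time] using hle) 2
  · obtain ⟨C, hC⟩ := exists_approx_uniform ℓ σ
    refine ⟨C, fun d hd a b hab s hs v g h => ?_⟩
    obtain ⟨m, hm⟩ := exists_isLeast_polyErrors k ℓ h.1
    obtain ⟨mx, hmx⟩ := exists_isLeast_spaceErrors ℓ h.1
    obtain ⟨mt, hmt⟩ := exists_isLeast_timeErrors hd k h
    refine ⟨m, mx, mt, hm, hmx, hmt, ?_⟩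
    -- The estimate is applied to the minimizers on the right-hand side; the resulting `vh` competes
    -- for the minimum on the left.
    obtain ⟨vx, -, hvx, hex⟩ := hmx.1
    obtain ⟨vt, r, hvt, hr, hrw, het⟩ := hmt.1
    obtain ⟨vh, hvh, hle⟩ := hC d hd a b hab s hs k v vx vt r h.1 hvx hvt hr hrw
    rw [hex, het, normL2Cell_eq_eLpNorm]
    refine (hm.2 ⟨vh, hvh, rfl⟩).trans ?_
    rw [normL2Cell_eq_eLpNorm]
    exact hle
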